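/- **Setting.** Let $n\ge 2$, let $\mathbb R^{n+3}_2$ be $\mathbb R^{n+3}$ with the inner product $\langle v,w\rangle=-v_1w_1-v_2w_2+\sum_{i\ge 3}v_iw_i$, and let $\mathbb Q^{n+1}_1\subset\mathbb RP^{n+2}$ be the conformal space of its null lines. Let $M$ be a connected smooth $n$-manifold and $x:M\to\mathbb Q^{n+1}_1$ a space-like hypersurface, i.e. a smooth map whose local lifts $y$ to the light cone have positive definite metric $\langle dy,dy\rangle$. Let $\Delta$ and $\kappa$ be the Laplacian and the normalized scalar curvature of $\langle dy,dy\rangle$. The conformal metric is $g=(n^2\kappa-\langle\Delta y,\Delta y\rangle)\langle dy,dy\rangle$; it does not depend on the lift. The hypersurface $x$ is *regular* if $g$ is nondegenerate. A *canonical* local lift is a lift $y$ with $\langle dy,dy\rangle=g$ (it is unique up to sign). For a canonical lift put $N=-\frac1n\Delta y-\frac1{2n^2}\langle\Delta y,\Delta y\rangle y$, and let $\xi$ be a conformal unit normal: $\langle\xi,\xi\rangle=-1$ and $\xi\perp y,N,dy$ (also unique up to sign). The Blaschke tensor $\mathbb A$, the conformal second fundamental form $\mathbb B$ and the conformal form $\phi$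 are given by $$A_{ij}=-\langle\partial_i\partial_j y,N\rangle,\qquad B_{ij}=-\langle\partial_i\partial_j y,\xi\rangle,\qquad C_i=-\langle\partial_i N,\xi\rangle .$$ Let $A=(A^i_j)$ and $B=(B^i_j)$ be the operators obtained from $\mathbb A,\mathbb B$ by raising an index with $g$; the eigenvalues of $A$ are the *Blaschke eigenvalues*. The hypersurface $x$ is *Blaschke isoparametric* if $\phi=0$ and the Blaschke eigenvalues, counted with multiplicity, are constant on $M$. **Lemma 2.2.** Let $x:M\to\mathbb Q^{n+1}_1$ be a regular space-like hypersurface whose Blaschke tensor is parallel, i.e. $A_{ij,k}=0$ for the Levi-Civita connection of $g$. Then: 1. $x$ is Blaschke isoparametric. 2. There are at most $3$ distinct Blaschke eigenvalues. 3. At every point (for either choice of $\xi$) $A$ and $B$ commute, and there is a common $g$-orthonormal basis $e_1,\dots,e_n$ with $Ae_i=a_ie_i$, $Be_i=b_ie_i$, such that $$a_i+a_j=b_ib_j\qquad\text{whenever } a_i\neq a_j .$$ If there are three distinct Blaschke eigenvalues, then moreover $B$ is a multiple of the identity on each eigenspace of $A$ ($a_i=a_j$ implies $b_i=b_j$), so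 that the relation reads $a_t+a_{t'}=b_tb_{t'}$ for $t\ne t'$, where $t,t'$ label the distinct Blaschke eigenvalues. -/

import Mathlib

open scoped Manifold ContDiff Matrix

noncomputable section

namespace ConformalGeometry

/-! ### Pseudo-Euclidean space and the conformal space -/

/-- The inner product of the pseudo-Euclidean space `ℝ^N_s`: the first `s` coordinates count
negatively, the others positively. -/
def pseudoInner (N s : ℕ) (v w : Fin N → ℝ) : ℝ :=
  ∑ i : Fin N, (if (i : ℕ) < s then -1 else 1) * v i * w i

/-- The conformal space `ℚ^m_s`: the null lines of `ℝ^{m+2}_{s+1}`, as a subset of the real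
projective space `ℝP^{m+1}`. -/
def conformalSpace (m s : ℕ) : Set (Projectivization ℝ (Fin (m + 2) → ℝ)) :=
  {p | ∀ v ∈ p.submodule, pseudoInner (m + 2) (s + 1) v v = 0}

/-! ### Coordinate tensor calculus on open subsets of `ℝⁿ` -/

/-- The `i`-th partial derivative. -/
def pd {n : ℕ} {F : Type*} [NormedAddCommGroup F] [NormedSpace ℝ F] (i : Fin n)
    (f : EuclideanSpace ℝ (Fin n) → F) (u : EuclideanSpace ℝ (Fin n)) : F :=
  fderiv ℝ f u (EuclideanSpace.single i 1)

/-- The Christoffel symbol `Γ^k_{ij}` of the metric with component matrix `G`. -/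
def christoffel {n : ℕ} (G : EuclideanSpace ℝ (Fin n) → Matrix (Fin n) (Fin n) ℝ)
    (k i j : Fin n) (u : EuclideanSpace ℝ (Fin n)) : ℝ :=
  (1 / 2) * ∑ l, (G u)⁻¹ k l *
    (pd i (fun w => G w j l) u + pd j (fun w => G w i l) u - pd l (fun w => G w i j) u)

/-- The Laplacian `Δ f = g^{ij} (∂_i ∂_j f - Γ^k_{ij} ∂_k f)` of a vector-valued function. -/
def laplacian {n : ℕ} {F : Type*} [NormedAddCommGroup F] [NormedSpace ℝ F]
    (G : EuclideanSpace ℝ (Fin n) → Matrix (Fin n) (Fin n) ℝ)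
    (f : EuclideanSpace ℝ (Fin n) → F) (u : EuclideanSpace ℝ (Fin n)) : F :=
  ∑ i, ∑ j, (G u)⁻¹ i j • (pd i (pd j f) u - ∑ k, christoffel G k i j u • pd k f u)

/-- The component `R^l_{kij}` of the curvature tensor: `R(∂_i, ∂_j) ∂_k = ∑ l, R^l_{kij} ∂_l`
with `R(X, Y) = [∇_X, ∇_Y] - ∇_{[X, Y]}`. -/
def curvature {n : ℕ} (G : EuclideanSpace ℝ (Fin n) → Matrix (Fin n) (Fin n) ℝ)
    (l k i j : Fin n) (u : EuclideanSpace ℝ (Fin n)) : ℝ :=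
  pd i (christoffel G l j k) u - pd j (christoffel G l i k) u
    + ∑ m, (christoffel G l i m u * christoffel G m j k u
      - christoffel G l j m u * christoffel G m i k u)

/-- The scalar curvature `∑ g^{kj} R^i_{kij}` (equal to `n (n - 1)` on the unit `n`-sphere). -/
def scalarCurvature {n : ℕ} (G : EuclideanSpace ℝ (Fin n) → Matrix (Fin n) (Fin n) ℝ)
    (u : EuclideanSpace ℝ (Fin n)) : ℝ :=
  ∑ k, ∑ j, (G u)⁻¹ k j * ∑ i, curvature G i k i j u

/-- The normalized scalar curvature `κ`, for `n ≥ 2`. -/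
def normalizedScalarCurvature {n : ℕ}
    (G : EuclideanSpace ℝ (Fin n) → Matrix (Fin n) (Fin n) ℝ)
    (u : EuclideanSpace ℝ (Fin n)) : ℝ :=
  scalarCurvature G u / ((n : ℝ) * ((n : ℝ) - 1))

/-- The component `T_{ij,k}` of the covariant derivative of a covariant 2-tensor `T` with respect
to the Levi-Civita connection of `G`. -/
def covDeriv {n : ℕ} (G T : EuclideanSpace ℝ (Fin n) → Matrix (Fin n) (Fin n) ℝ)
    (i j k : Fin n) (u : EuclideanSpace ℝ (Fin n)) : ℝ :=
  pd k (fun w => T w i j) u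
    - ∑ l, christoffel G l k i u * T u l j - ∑ l, christoffel G l k j u * T u i l

/-! ### Lifts of hypersurfaces and their invariants

Below `Y` is a map from (an open subset of) `ℝⁿ` to `ℝ^{n+3}_2`, the coordinate expression of a
lift of a hypersurface of `ℚ^{n+1}_1` to the light cone. -/

/-- The inner product of the ambient space `ℝ^{n+3}_2`. -/
def ip {n : ℕ} (v w : Fin (n + 1 + 2) → ℝ) : ℝ := pseudoInner (n + 1 + 2) 2 v w

/-- The components `⟨∂_i Y, ∂_j Y⟩` of the metric `⟨dY, dY⟩`. -/
def inducedMetric {n : ℕ} (Y : EuclideanSpace ℝ (Fin n) → Fin (n + 1 + 2) → ℝ)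
    (u : EuclideanSpace ℝ (Fin n)) : Matrix (Fin n) (Fin n) ℝ :=
  Matrix.of fun i j => ip (pd i Y u) (pd j Y u)

/-- The Laplacian `ΔY` of `Y` with respect to `⟨dY, dY⟩`. -/
def lap {n : ℕ} (Y : EuclideanSpace ℝ (Fin n) → Fin (n + 1 + 2) → ℝ)
    (u : EuclideanSpace ℝ (Fin n)) : Fin (n + 1 + 2) → ℝ :=
  laplacian (inducedMetric Y) Y u

/-- The components of the conformal metric `g = (n² κ - ⟨ΔY, ΔY⟩) ⟨dY, dY⟩`, where `Δ` and `κ` are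
the Laplacian and the normalized scalar curvature of `⟨dY, dY⟩`. It does not depend on the lift. -/
def conformalMetric {n : ℕ} (Y : EuclideanSpace ℝ (Fin n) → Fin (n + 1 + 2) → ℝ)
    (u : EuclideanSpace ℝ (Fin n)) : Matrix (Fin n) (Fin n) ℝ :=
  ((n : ℝ) ^ 2 * normalizedScalarCurvature (inducedMetric Y) u - ip (lap Y u) (lap Y u)) •
    inducedMetric Y u

/-- The null vector field `N = -(1/n) ΔY - (1/(2n²)) ⟨ΔY, ΔY⟩ Y` of the conformal frame. -/
def conformalN {n : ℕ} (Y : EuclideanSpace ℝ (Fin n) → Fin (n + 1 + 2) → ℝ)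
    (u : EuclideanSpace ℝ (Fin n)) : Fin (n + 1 + 2) → ℝ :=
  (-(1 / (n : ℝ))) • lap Y u - (1 / (2 * (n : ℝ) ^ 2) * ip (lap Y u) (lap Y u)) • Y u

/-- `ξ` is a conformal unit normal vector at `u`: time-like of length `-1` and orthogonal to `Y`,
`N` and all `∂_i Y`. It is determined up to sign. -/
structure IsConformalNormal {n : ℕ} (Y : EuclideanSpace ℝ (Fin n) → Fin (n + 1 + 2) → ℝ)
    (u : EuclideanSpace ℝ (Fin n)) (ξ : Fin (n + 1 + 2) → ℝ) : Prop where
  unit : ip ξ ξ = -1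
  orth_lift : ip ξ (Y u) = 0
  orth_N : ip ξ (conformalN Y u) = 0
  orth_tangent : ∀ i, ip ξ (pd i Y u) = 0

/-- The components `A_{ij}` of the Blaschke tensor of a canonical lift `Y`. Together with
`conformalSecondForm` they are the coefficients of the structure equation
`Y_{,ij} = -A_{ij} Y - g_{ij} N + B_{ij} ξ`; equivalently `A_{ij} = ⟨∂_i Y, ∂_j N⟩`. -/
def blaschkeTensor {n : ℕ} (Y : EuclideanSpace ℝ (Fin n) → Fin (n + 1 + 2) → ℝ)
    (u : EuclideanSpace ℝ (Fin n)) : Matrix (Fin n) (Fin n) ℝ :=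
  Matrix.of fun i j => -ip (pd i (pd j Y) u) (conformalN Y u)

/-- The components `B_{ij}` of the conformal second fundamental form of a canonical lift `Y` with
respect to the conformal unit normal vector `ξ`. -/
def conformalSecondForm {n : ℕ} (Y : EuclideanSpace ℝ (Fin n) → Fin (n + 1 + 2) → ℝ)
    (ξ : Fin (n + 1 + 2) → ℝ) (u : EuclideanSpace ℝ (Fin n)) : Matrix (Fin n) (Fin n) ℝ :=
  Matrix.of fun i j => -ip (pd i (pd j Y) u) ξ

/-- The components `C_i` of the conformal form of a canonical lift `Y`, the `ξ`-coefficients in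
`∂_i N = ∑ A^j_i ∂_j Y + C_i ξ`. -/
def conformalForm {n : ℕ} (Y : EuclideanSpace ℝ (Fin n) → Fin (n + 1 + 2) → ℝ)
    (ξ : Fin (n + 1 + 2) → ℝ) (u : EuclideanSpace ℝ (Fin n)) (i : Fin n) : ℝ :=
  -ip (pd i (conformalN Y) u) ξ

/-- The Blaschke operator `A^i_j = g^{ik} A_{kj}` of a canonical lift. -/
def blaschkeOperator {n : ℕ} (Y : EuclideanSpace ℝ (Fin n) → Fin (n + 1 + 2) → ℝ)
    (u : EuclideanSpace ℝ (Fin n)) : Matrix (Fin n) (Fin n) ℝ :=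
  (inducedMetric Y u)⁻¹ * blaschkeTensor Y u

/-- The operator `B^i_j = g^{ik} B_{kj}` of a canonical lift. -/
def secondFormOperator {n : ℕ} (Y : EuclideanSpace ℝ (Fin n) → Fin (n + 1 + 2) → ℝ)
    (ξ : Fin (n + 1 + 2) → ℝ) (u : EuclideanSpace ℝ (Fin n)) : Matrix (Fin n) (Fin n) ℝ :=
  (inducedMetric Y u)⁻¹ * conformalSecondForm Y ξ u

/-! ### Hypersurfaces -/

section Hypersurface

variable {n : ℕ} {M : Type*} [TopologicalSpace M] [ChartedSpace (EuclideanSpace ℝ (Fin n)) M]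

/-- `Y` is the coordinate expression, in the chart `φ` of the smooth manifold `M`, of a smooth lift
of `x` to the light cone over the domain of `φ`. -/
structure IsLocalLift (x : M → conformalSpace (n + 1) 1)
    (φ : OpenPartialHomeomorph M (EuclideanSpace ℝ (Fin n)))
    (Y : EuclideanSpace ℝ (Fin n) → Fin (n + 1 + 2) → ℝ) : Prop where
  chart : φ ∈ IsManifold.maximalAtlas (𝓡 n) ∞ M
  smooth : ContDiffOn ℝ ∞ Y φ.target
  lifts : ∀ u ∈ φ.target, ∃ h : Y u ≠ 0,
    Projectivization.mk ℝ (Y u) h = (x (φ.symm u) : Projectivization ℝ (Fin (n + 1 + 2) → ℝ))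

/-- `x : M → ℚ^{n+1}_1` is a regular space-like hypersurface: it is smooth (it has smooth lifts
near every point), the metrics `⟨dY, dY⟩` of its lifts are positive definite (so that it is a
space-like immersion), and its conformal metric is nondegenerate. -/
structure IsRegularSpacelike (x : M → conformalSpace (n + 1) 1) : Prop where
  exists_lift : ∀ p : M, ∃ φ Y, IsLocalLift x φ Y ∧ p ∈ φ.source
  spacelike : ∀ φ Y, IsLocalLift x φ Y → ∀ u ∈ φ.target, (inducedMetric Y u).PosDef
  regular : ∀ φ Y, IsLocalLift x φ Y → ∀ u ∈ φ.target, (conformalMetric Y u).det ≠ 0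

/-- A canonical lift: one with `⟨dY, dY⟩ = g`, the conformal metric. -/
structure IsCanonicalLift (x : M → conformalSpace (n + 1) 1)
    (φ : OpenPartialHomeomorph M (EuclideanSpace ℝ (Fin n)))
    (Y : EuclideanSpace ℝ (Fin n) → Fin (n + 1 + 2) → ℝ) : Prop where
  isLocalLift : IsLocalLift x φ Y
  canonical : ∀ u ∈ φ.target, inducedMetric Y u = conformalMetric Y u

/-- The Blaschke tensor is parallel: `A_{ij,k} = 0`. -/
def HasParallelBlaschkeTensor (x : M → conformalSpace (n + 1) 1) : Prop :=
  ∀ φ Y, IsCanonicalLift x φ Y → ∀ u ∈ φ.target, ∀ i j k,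
    covDeriv (inducedMetric Y) (blaschkeTensor Y) i j k u = 0

/-- The conformal form vanishes identically. -/
def HasVanishingConformalForm (x : M → conformalSpace (n + 1) 1) : Prop :=
  ∀ φ Y, IsCanonicalLift x φ Y → ∀ u ∈ φ.target, ∀ ξ, IsConformalNormal Y u ξ →
    ∀ i, conformalForm Y ξ u i = 0

/-- The Blaschke eigenvalues are constant on `M`, with their multiplicities. -/
def HasConstantBlaschkeEigenvalues (x : M → conformalSpace (n + 1) 1) : Prop :=
  ∃ a : Fin n → ℝ, ∀ φ Y, IsCanonicalLift x φ Y → ∀ u ∈ φ.target,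
    (blaschkeOperator Y u).charpoly = ∏ i, (Polynomial.X - Polynomial.C (a i))

/-- Blaschke isoparametric hypersurfaces: the conformal form vanishes and the Blaschke eigenvalues
are constant. -/
structure IsBlaschkeIsoparametric (x : M → conformalSpace (n + 1) 1) : Prop where
  conformalForm_eq_zero : HasVanishingConformalForm x
  eigenvalues_const : HasConstantBlaschkeEigenvalues x

/-- `a` is a Blaschke eigenvalue of `x` at the point `p`. -/
def IsBlaschkeEigenvalue (x : M → conformalSpace (n + 1) 1) (p : M) (a : ℝ) : Prop :=
  ∃ φ Y, IsCanonicalLift x φ Y ∧ p ∈ φ.source ∧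
    ∃ v : Fin n → ℝ, v ≠ 0 ∧ blaschkeOperator Y (φ p) *ᵥ v = a • v

end Hypersurface

end ConformalGeometry

end

open ConformalGeometry

/-! Along a lift the vectors $Y$, $N$, $\partial_iY$, $\xi$ form a moving frame, and everything
follows from its structure equations. The second covariant derivative $Y_{,ij}$ is normal to $dY$,
so $\langle Y_{,ij},Y_{,kl}\rangle=A_{ij}g_{kl}+g_{ij}A_{kl}-B_{ij}B_{kl}$, which turns `gauss` into
a formula for the curvature in terms of $A$ and $B$. Contracting it shows that
$n^2\kappa-\langle\Delta Y,\Delta Y\rangle$ is $\frac n{n-1}$ times the squared norm of the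
trace-free second fundamental form. Hence this factor is nonnegative and scales with weight $-2$.
Regularity makes it positive, so canonical lifts exist, and on them $B$ is trace-free and nonzero.

Let $\nabla A=0$. The equation `codazzi` becomes $C_kB_{ij}=C_iB_{kj}$. Its $g$-trace gives $BC=0$,
its contraction with $B$ then gives $|B|^2C=0$, and so $\phi=0$. Now
$\partial_iN=A^l_i\,\partial_lY$, and symmetry of $\partial_k\partial_iN$ makes $A$ and $B$ commute.
Moreover $A$ commutes with every curvature operator, so $\langle R(\cdot,\cdot)y,x\rangle=0$ for
eigenvectors $x,y$ of $A$ with different eigenvalues. By Gauss this is $(a_1+a_2-b_1b_2)$ times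
$x\wedge y$, which is the eigenvalue relation (`add_eq_mul_of_ne`).

The rest is algebra and gluing. For four distinct values, $(a_0+a_1)(a_2+a_3)$ and
$(a_0+a_2)(a_1+a_3)$ both equal $b_0b_1b_2b_3$, and their difference $(a_0-a_3)(a_2-a_1)$ is not
zero. Since $\partial_kA=[A,\Gamma_k]$, the characteristic polynomial of $A$ is locally constant.
Between canonical lifts $A$ changes by conjugation, so this polynomial is a function on the
connected $M$ and is constant with multiplicities. -/

noncomputable section

namespace ConformalGeometry

/-! ### Algebra of the ambient inner product -/

section InnerProduct

variable {n : ℕ}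

/-- The ambient inner product as a bilinear map. -/
def ipForm (n : ℕ) : (Fin (n + 1 + 2) → ℝ) →ₗ[ℝ] (Fin (n + 1 + 2) → ℝ) →ₗ[ℝ] ℝ :=
  LinearMap.mk₂ ℝ (fun v w => ip (n := n) v w)
    (fun v v' w => by
      simp only [ip, pseudoInner, ← Finset.sum_add_distrib]
      exact Finset.sum_congr rfl fun i _ => by simp only [Pi.add_apply]; ring)
    (fun c v w => by
      simp only [ip, pseudoInner, smul_eq_mul, Finset.mul_sum]
      exact Finset.sum_congr rfl fun i _ => by simp only [Pi.smul_apply, smul_eq_mul]; ring)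
    (fun v w w' => by
      simp only [ip, pseudoInner, ← Finset.sum_add_distrib]
      exact Finset.sum_congr rfl fun i _ => by simp only [Pi.add_apply]; ring)
    (fun c v w => by
      simp only [ip, pseudoInner, smul_eq_mul, Finset.mul_sum]
      exact Finset.sum_congr rfl fun i _ => by simp only [Pi.smul_apply, smul_eq_mul]; ring)

theorem ipForm_apply (v w : Fin (n + 1 + 2) → ℝ) : ipForm n v w = ip v w := rfl

theorem ip_comm (v w : Fin (n + 1 + 2) → ℝ) : ip v w = ip w v := by
  simp only [ip, pseudoInner]
  exact Finset.sum_congr rfl fun i _ => by ring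

theorem ip_add_left (v v' w : Fin (n + 1 + 2) → ℝ) : ip (v + v') w = ip v w + ip v' w :=
  (ipForm n).map_add₂ v v' w

theorem ip_add_right (v w w' : Fin (n + 1 + 2) → ℝ) : ip v (w + w') = ip v w + ip v w' :=
  (ipForm n v).map_add w w'

theorem ip_sub_left (v v' w : Fin (n + 1 + 2) → ℝ) : ip (v - v') w = ip v w - ip v' w :=
  (ipForm n).map_sub₂ v v' w

theorem ip_sub_right (v w w' : Fin (n + 1 + 2) → ℝ) : ip v (w - w') = ip v w - ip v w' :=
  (ipForm n v).map_sub w w'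

theorem ip_smul_left (c : ℝ) (v w : Fin (n + 1 + 2) → ℝ) : ip (c • v) w = c * ip v w :=
  (ipForm n).map_smul₂ c v w

theorem ip_smul_right (c : ℝ) (v w : Fin (n + 1 + 2) → ℝ) : ip v (c • w) = c * ip v w :=
  (ipForm n v).map_smul c w

theorem ip_zero_left (w : Fin (n + 1 + 2) → ℝ) : ip 0 w = 0 :=
  (ipForm n).map_zero₂ w

theorem ip_sum_left {ι : Type*} (s : Finset ι) (f : ι → Fin (n + 1 + 2) → ℝ)
    (w : Fin (n + 1 + 2) → ℝ) : ip (∑ i ∈ s, f i) w = ∑ i ∈ s, ip (f i) w := by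
  simp only [← ipForm_apply, map_sum, LinearMap.sum_apply]

theorem ip_sum_right {ι : Type*} (s : Finset ι) (f : ι → Fin (n + 1 + 2) → ℝ)
    (v : Fin (n + 1 + 2) → ℝ) : ip v (∑ i ∈ s, f i) = ∑ i ∈ s, ip v (f i) := by
  simp only [← ipForm_apply, map_sum]

end InnerProduct

/-! ### Partial derivatives -/

section PartialDerivatives

variable {n : ℕ} {F : Type*} [NormedAddCommGroup F] [NormedSpace ℝ F]
  {U : Set (EuclideanSpace ℝ (Fin n))} {u : EuclideanSpace ℝ (Fin n)}

theorem pd_congr {f g : EuclideanSpace ℝ (Fin n) → F} (h : f =ᶠ[nhds u] g) (i : Fin n) :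
    pd i f u = pd i g u := by
  rw [pd, pd, h.fderiv_eq]

theorem pd_congr_of_eqOn (hU : IsOpen U) (hu : u ∈ U) {f g : EuclideanSpace ℝ (Fin n) → F}
    (h : ∀ w ∈ U, f w = g w) (i : Fin n) : pd i f u = pd i g u :=
  pd_congr (Filter.eventuallyEq_of_mem (hU.mem_nhds hu) h) i

theorem pd_const (c : F) (i : Fin n) : pd i (fun _ => c) u = 0 := by
  simp [pd]

theorem pd_add {f g : EuclideanSpace ℝ (Fin n) → F} (hf : DifferentiableAt ℝ f u)
    (hg : DifferentiableAt ℝ g u) (i : Fin n) :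
    pd i (fun w => f w + g w) u = pd i f u + pd i g u := by
  rw [pd, fderiv_fun_add hf hg]; rfl

theorem pd_sub {f g : EuclideanSpace ℝ (Fin n) → F} (hf : DifferentiableAt ℝ f u)
    (hg : DifferentiableAt ℝ g u) (i : Fin n) :
    pd i (fun w => f w - g w) u = pd i f u - pd i g u := by
  rw [pd, fderiv_fun_sub hf hg]; rfl

theorem pd_sum {ι : Type*} {s : Finset ι} {f : ι → EuclideanSpace ℝ (Fin n) → F}
    (hf : ∀ j ∈ s, DifferentiableAt ℝ (f j) u) (i : Fin n) :
    pd i (fun w => ∑ j ∈ s, f j w) u = ∑ j ∈ s, pd i (f j) u := by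
  rw [pd, fderiv_fun_sum hf, sum_apply]; rfl

theorem pd_smul {c : EuclideanSpace ℝ (Fin n) → ℝ} {f : EuclideanSpace ℝ (Fin n) → F}
    (hc : DifferentiableAt ℝ c u) (hf : DifferentiableAt ℝ f u) (i : Fin n) :
    pd i (fun w => c w • f w) u = pd i c u • f u + c u • pd i f u := by
  rw [pd, fderiv_fun_smul hc hf, add_comm]; rfl

theorem pd_mul {c f : EuclideanSpace ℝ (Fin n) → ℝ}
    (hc : DifferentiableAt ℝ c u) (hf : DifferentiableAt ℝ f u) (i : Fin n) :
    pd i (fun w => c w * f w) u = pd i c u * f u + c u * pd i f u := by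
  simpa only [smul_eq_mul] using pd_smul hc hf i

theorem pd_apply {ι : Type*} [Fintype ι] {f : EuclideanSpace ℝ (Fin n) → ι → F}
    (hf : DifferentiableAt ℝ f u) (i : Fin n) (j : ι) :
    pd i f u j = pd i (fun w => f w j) u := by
  have h := (hasFDerivAt_pi'.1 hf.hasFDerivAt j).fderiv
  rw [pd, pd, h]; rfl

theorem contDiffOn_pd (hU : IsOpen U) {f : EuclideanSpace ℝ (Fin n) → F}
    (hf : ContDiffOn ℝ ∞ f U) (i : Fin n) : ContDiffOn ℝ ∞ (pd i f) U :=
  (hf.fderiv_of_isOpen hU (by simp)).clm_apply contDiffOn_const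

theorem differentiableAt_of_contDiffOn (hU : IsOpen U) (hu : u ∈ U)
    {f : EuclideanSpace ℝ (Fin n) → F} (hf : ContDiffOn ℝ ∞ f U) : DifferentiableAt ℝ f u :=
  (hf.contDiffAt (hU.mem_nhds hu)).differentiableAt (by simp)

theorem pd_comm (hU : IsOpen U) (hu : u ∈ U) {f : EuclideanSpace ℝ (Fin n) → F}
    (hf : ContDiffOn ℝ ∞ f U) (i j : Fin n) : pd i (pd j f) u = pd j (pd i f) u := by
  have hd : DifferentiableAt ℝ (fderiv ℝ f) u :=
    differentiableAt_of_contDiffOn hU hu (hf.fderiv_of_isOpen hU (by simp))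
  have key : ∀ a b : Fin n, pd a (pd b f) u =
      fderiv ℝ (fderiv ℝ f) u (EuclideanSpace.single a 1) (EuclideanSpace.single b 1) := by
    intro a b
    have h := hd.hasFDerivAt.clm_apply
      (hasFDerivAt_const (EuclideanSpace.single b (1 : ℝ)) u)
    change fderiv ℝ (fun w => fderiv ℝ f w (EuclideanSpace.single b 1)) u _ = _
    rw [h.fderiv]
    simp
  rw [key, key]
  refine ((hf.contDiffAt (hU.mem_nhds hu)).isSymmSndFDerivAt ?_).eq _ _
  rw [minSmoothness_of_isRCLikeNormedField]
  exact WithTop.coe_le_coe.2 le_top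

theorem contDiffOn_ip {f g : EuclideanSpace ℝ (Fin n) → Fin (n + 1 + 2) → ℝ}
    (hf : ContDiffOn ℝ ∞ f U) (hg : ContDiffOn ℝ ∞ g U) :
    ContDiffOn ℝ ∞ (fun w => ip (f w) (g w)) U := by
  rw [contDiffOn_pi] at hf hg
  simp only [ip, pseudoInner]
  exact ContDiffOn.sum fun i _ => (contDiffOn_const.mul (hf i)).mul (hg i)

theorem pd_ip {f g : EuclideanSpace ℝ (Fin n) → Fin (n + 1 + 2) → ℝ}
    (hf : DifferentiableAt ℝ f u) (hg : DifferentiableAt ℝ g u) (i : Fin n) :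
    pd i (fun w => ip (f w) (g w)) u = ip (pd i f u) (g u) + ip (f u) (pd i g u) := by
  have hf' := differentiableAt_pi.1 hf
  have hg' := differentiableAt_pi.1 hg
  simp only [ip, pseudoInner]
  rw [pd_sum (f := fun (j : Fin (n + 1 + 2)) w => (if (j : ℕ) < 2 then -1 else 1) * f w j * g w j)
    (fun j _ => ((hf' j).const_mul _).mul (hg' j)), ← Finset.sum_add_distrib]
  refine Finset.sum_congr rfl fun j _ => ?_
  rw [pd_mul ((hf' j).const_mul _) (hg' j), pd_mul (differentiableAt_const _) (hf' j), pd_const,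
    pd_apply hf, pd_apply hg]
  ring

/-! ### Smooth matrix-valued functions -/

theorem contDiffOn_det {m : ℕ} {A : EuclideanSpace ℝ (Fin n) → Matrix (Fin m) (Fin m) ℝ}
    (hA : ∀ i j, ContDiffOn ℝ ∞ (fun w => A w i j) U) :
    ContDiffOn ℝ ∞ (fun w => (A w).det) U := by
  simp only [Matrix.det_apply']
  exact ContDiffOn.sum fun σ _ => contDiffOn_const.mul (contDiffOn_prod fun i _ => hA _ _)

theorem contDiffOn_inv {m : ℕ} {A : EuclideanSpace ℝ (Fin n) → Matrix (Fin m) (Fin m) ℝ}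
    (hA : ∀ i j, ContDiffOn ℝ ∞ (fun w => A w i j) U) (h0 : ∀ w ∈ U, (A w).det ≠ 0)
    (i j : Fin m) : ContDiffOn ℝ ∞ (fun w => (A w)⁻¹ i j) U := by
  simp only [Matrix.inv_def, Ring.inverse_eq_inv', Matrix.smul_apply, smul_eq_mul,
    Matrix.adjugate_apply]
  refine ((contDiffOn_det hA).inv h0).mul (contDiffOn_det fun a b => ?_)
  simp only [Matrix.updateRow_apply]
  split_ifs
  · exact contDiffOn_const
  · exact hA a b

theorem contDiffOn_mul_apply {m : ℕ} {A B : EuclideanSpace ℝ (Fin n) → Matrix (Fin m) (Fin m) ℝ}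
    (hA : ∀ i j, ContDiffOn ℝ ∞ (fun w => A w i j) U)
    (hB : ∀ i j, ContDiffOn ℝ ∞ (fun w => B w i j) U) (i j : Fin m) :
    ContDiffOn ℝ ∞ (fun w => (A w * B w) i j) U := by
  simp only [Matrix.mul_apply]
  exact ContDiffOn.sum fun k _ => (hA i k).mul (hB k j)

/-- The entrywise partial derivative of a matrix-valued function. -/
def pdMat {m : ℕ} (k : Fin n) (A : EuclideanSpace ℝ (Fin n) → Matrix (Fin m) (Fin m) ℝ)
    (u : EuclideanSpace ℝ (Fin n)) : Matrix (Fin m) (Fin m) ℝ :=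
  Matrix.of fun i j => pd k (fun w => A w i j) u

theorem pdMat_apply {m : ℕ} (k : Fin n) (A : EuclideanSpace ℝ (Fin n) → Matrix (Fin m) (Fin m) ℝ)
    (u : EuclideanSpace ℝ (Fin n)) (i j : Fin m) :
    pdMat k A u i j = pd k (fun w => A w i j) u := rfl

theorem pdMat_congr_of_eqOn {m : ℕ} (hU : IsOpen U) (hu : u ∈ U)
    {A B : EuclideanSpace ℝ (Fin n) → Matrix (Fin m) (Fin m) ℝ}
    (h : ∀ w ∈ U, A w = B w) (k : Fin n) : pdMat k A u = pdMat k B u := by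
  ext i j
  exact pd_congr_of_eqOn hU hu (fun w hw => by rw [h w hw]) k

theorem pdMat_mul {m : ℕ} {A B : EuclideanSpace ℝ (Fin n) → Matrix (Fin m) (Fin m) ℝ}
    (hA : ∀ i j, DifferentiableAt ℝ (fun w => A w i j) u)
    (hB : ∀ i j, DifferentiableAt ℝ (fun w => B w i j) u) (k : Fin n) :
    pdMat k (fun w => A w * B w) u = pdMat k A u * B u + A u * pdMat k B u := by
  ext i j
  simp only [Matrix.add_apply, Matrix.mul_apply, pdMat_apply, ← Finset.sum_add_distrib]
  rw [pd_sum (f := fun l w => A w i l * B w l j) fun l _ => (hA i l).mul (hB l j)]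
  exact Finset.sum_congr rfl fun l _ => pd_mul (hA i l) (hB l j) k

theorem pdMat_sub {m : ℕ} {A B : EuclideanSpace ℝ (Fin n) → Matrix (Fin m) (Fin m) ℝ}
    (hA : ∀ i j, DifferentiableAt ℝ (fun w => A w i j) u)
    (hB : ∀ i j, DifferentiableAt ℝ (fun w => B w i j) u) (k : Fin n) :
    pdMat k (fun w => A w - B w) u = pdMat k A u - pdMat k B u := by
  ext i j
  exact pd_sub (hA i j) (hB i j) k

theorem pdMat_comm {m : ℕ} (hU : IsOpen U) (hu : u ∈ U)
    {A : EuclideanSpace ℝ (Fin n) → Matrix (Fin m) (Fin m) ℝ}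
    (hA : ∀ i j, ContDiffOn ℝ ∞ (fun w => A w i j) U) (k l : Fin n) :
    pdMat k (pdMat l A) u = pdMat l (pdMat k A) u := by
  ext i j
  exact pd_comm hU hu (hA i j) k l

/-- Jacobi's formula for the derivative of a determinant. -/
theorem pd_det {m : ℕ} {A : EuclideanSpace ℝ (Fin n) → Matrix (Fin m) (Fin m) ℝ}
    (hA : ∀ i j, DifferentiableAt ℝ (fun w => A w i j) u) (k : Fin n) :
    pd k (fun w => (A w).det) u = ((A u).adjugate * pdMat k A u).trace := by
  let R : EuclideanSpace ℝ (Fin n) → Fin m → Fin m → ℝ := fun w i j => A w i j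
  have hR : DifferentiableAt ℝ R u :=
    differentiableAt_pi.2 fun i => differentiableAt_pi.2 fun j => hA i j
  -- The determinant is multilinear in the rows, so its derivative is the sum over $i$ of the
  -- determinants with row $i$ replaced by its derivative. Cramer's rule turns each of them into a
  -- diagonal entry of a product with the adjugate.
  let D : ContinuousMultilinearMap ℝ (fun _ : Fin m => Fin m → ℝ) ℝ :=
    ⟨(Matrix.detRowAlternating (n := Fin m) (R := ℝ)).toMultilinearMap, by
      change Continuous fun A : Fin m → Fin m → ℝ => Matrix.det (Matrix.of A)
      exact Continuous.matrix_det (by fun_prop)⟩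
  have h1 : pd k (fun w => (A w).det) u = D.linearDeriv (R u) (pd k R u) :=
    congrArg (fun L => L (EuclideanSpace.single k (1 : ℝ)))
      ((D.hasFDerivAt (R u)).comp u hR.hasFDerivAt).fderiv
  have h2 : ∀ i, pd k R u i = fun j => pdMat k A u i j := by
    intro i
    funext j
    rw [pd_apply hR, pd_apply (differentiableAt_pi.1 hR i)]
    rfl
  rw [h1, ContinuousMultilinearMap.linearDeriv_apply, Matrix.trace_mul_comm, Matrix.trace]
  refine Finset.sum_congr rfl fun i _ => ?_
  rw [h2]
  change ((A u).updateRow i fun j => pdMat k A u i j).det = _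
  rw [Matrix.diag_apply, Matrix.mul_apply, ← Matrix.cramer_transpose_apply,
    Matrix.cramer_eq_adjugate_mulVec, ← Matrix.adjugate_transpose]
  simp only [Matrix.mulVec, dotProduct, Matrix.transpose_apply, mul_comm]

end PartialDerivatives

/-! ### Structure equations of a lift -/

section StructureEquations

variable {n : ℕ} {U : Set (EuclideanSpace ℝ (Fin n))} {u : EuclideanSpace ℝ (Fin n)}
  {Y : EuclideanSpace ℝ (Fin n) → Fin (n + 1 + 2) → ℝ}

/-- `Y` is a smooth space-like map from the open set `U` to the light cone. -/
structure IsSpacelikeLift (U : Set (EuclideanSpace ℝ (Fin n)))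
    (Y : EuclideanSpace ℝ (Fin n) → Fin (n + 1 + 2) → ℝ) : Prop where
  isOpen : IsOpen U
  smooth : ContDiffOn ℝ ∞ Y U
  null : ∀ u ∈ U, ip (Y u) (Y u) = 0
  posDef : ∀ u ∈ U, (inducedMetric Y u).PosDef

/-- The component `Y_{,ij}` of the second covariant derivative of `Y`. -/
def secondCov (Y : EuclideanSpace ℝ (Fin n) → Fin (n + 1 + 2) → ℝ) (i j : Fin n)
    (u : EuclideanSpace ℝ (Fin n)) : Fin (n + 1 + 2) → ℝ :=
  pd i (pd j Y) u - ∑ k, christoffel (inducedMetric Y) k i j u • pd k Y u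

theorem lap_eq (Y : EuclideanSpace ℝ (Fin n) → Fin (n + 1 + 2) → ℝ)
    (u : EuclideanSpace ℝ (Fin n)) :
    lap Y u = ∑ i, ∑ j, (inducedMetric Y u)⁻¹ i j • secondCov Y i j u := rfl

theorem inducedMetric_apply (Y : EuclideanSpace ℝ (Fin n) → Fin (n + 1 + 2) → ℝ)
    (u : EuclideanSpace ℝ (Fin n)) (i j : Fin n) :
    inducedMetric Y u i j = ip (pd i Y u) (pd j Y u) := rfl

theorem inducedMetric_transpose (Y : EuclideanSpace ℝ (Fin n) → Fin (n + 1 + 2) → ℝ)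
    (u : EuclideanSpace ℝ (Fin n)) : (inducedMetric Y u)ᵀ = inducedMetric Y u := by
  ext i j
  exact ip_comm _ _

theorem inducedMetric_inv_transpose (Y : EuclideanSpace ℝ (Fin n) → Fin (n + 1 + 2) → ℝ)
    (u : EuclideanSpace ℝ (Fin n)) : (inducedMetric Y u)⁻¹ᵀ = (inducedMetric Y u)⁻¹ := by
  rw [Matrix.transpose_nonsing_inv, inducedMetric_transpose]

/-- The matrix `(Γ^l_{ik})_{lk}`. -/
def christoffelMat (Y : EuclideanSpace ℝ (Fin n) → Fin (n + 1 + 2) → ℝ) (i : Fin n)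
    (u : EuclideanSpace ℝ (Fin n)) : Matrix (Fin n) (Fin n) ℝ :=
  Matrix.of fun l k => christoffel (inducedMetric Y) l i k u

/-- The curvature operator `R(∂_i, ∂_j)`. -/
def curvatureMat (Y : EuclideanSpace ℝ (Fin n) → Fin (n + 1 + 2) → ℝ) (i j : Fin n)
    (u : EuclideanSpace ℝ (Fin n)) : Matrix (Fin n) (Fin n) ℝ :=
  Matrix.of fun l k => curvature (inducedMetric Y) l k i j u

theorem curvatureMat_eq (Y : EuclideanSpace ℝ (Fin n) → Fin (n + 1 + 2) → ℝ) (i j : Fin n)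
    (u : EuclideanSpace ℝ (Fin n)) :
    curvatureMat Y i j u = pdMat i (christoffelMat Y j) u - pdMat j (christoffelMat Y i) u
      + (christoffelMat Y i u * christoffelMat Y j u
        - christoffelMat Y j u * christoffelMat Y i u) := by
  ext l k
  simp only [curvatureMat, curvature, Matrix.of_apply, Matrix.add_apply, Matrix.sub_apply,
    Matrix.mul_apply, Finset.sum_sub_distrib]
  rfl

namespace IsSpacelikeLift

variable (h : IsSpacelikeLift U Y)
include h

/-! ### Smoothness of the tensors of a lift -/

theorem smooth_pd (i : Fin n) : ContDiffOn ℝ ∞ (pd i Y) U := contDiffOn_pd h.isOpen h.smooth i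

theorem smooth_pd_pd (i j : Fin n) : ContDiffOn ℝ ∞ (pd i (pd j Y)) U :=
  contDiffOn_pd h.isOpen (h.smooth_pd j) i

theorem smooth_metric (i j : Fin n) : ContDiffOn ℝ ∞ (fun w => inducedMetric Y w i j) U :=
  contDiffOn_ip (h.smooth_pd i) (h.smooth_pd j)

theorem det_ne_zero (hu : u ∈ U) : (inducedMetric Y u).det ≠ 0 := (h.posDef u hu).det_pos.ne'

theorem isUnit_det (hu : u ∈ U) : IsUnit (inducedMetric Y u).det := (h.det_ne_zero hu).isUnit

theorem inv_mul (hu : u ∈ U) : (inducedMetric Y u)⁻¹ * inducedMetric Y u = 1 :=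
  Matrix.nonsing_inv_mul _ (h.isUnit_det hu)

theorem mul_inv (hu : u ∈ U) : inducedMetric Y u * (inducedMetric Y u)⁻¹ = 1 :=
  Matrix.mul_nonsing_inv _ (h.isUnit_det hu)

theorem smooth_inv (i j : Fin n) : ContDiffOn ℝ ∞ (fun w => (inducedMetric Y w)⁻¹ i j) U :=
  contDiffOn_inv h.smooth_metric (fun _ hw => h.det_ne_zero hw) i j

theorem smooth_christoffel (k i j : Fin n) :
    ContDiffOn ℝ ∞ (christoffel (inducedMetric Y) k i j) U := by
  refine contDiffOn_const.mul (ContDiffOn.sum fun l _ => (h.smooth_inv k l).mul ?_)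
  exact ((contDiffOn_pd h.isOpen (h.smooth_metric j l) i).add
    (contDiffOn_pd h.isOpen (h.smooth_metric i l) j)).sub
    (contDiffOn_pd h.isOpen (h.smooth_metric i j) l)

theorem smooth_secondCov (i j : Fin n) : ContDiffOn ℝ ∞ (secondCov Y i j) U :=
  (h.smooth_pd_pd i j).sub
    (ContDiffOn.sum fun k _ => (h.smooth_christoffel k i j).smul (h.smooth_pd k))

theorem smooth_lap : ContDiffOn ℝ ∞ (lap Y) U := by
  have h1 : ContDiffOn ℝ ∞ (fun w => ∑ i, ∑ j, (inducedMetric Y w)⁻¹ i j • secondCov Y i j w) U :=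
    ContDiffOn.sum fun i _ => ContDiffOn.sum fun j _ =>
      (h.smooth_inv i j).fun_smul (h.smooth_secondCov i j)
  exact h1

theorem smooth_conformalN : ContDiffOn ℝ ∞ (conformalN Y) U := by
  have h1 : ContDiffOn ℝ ∞ (fun w => (-(1 / (n : ℝ))) • lap Y w
      - (1 / (2 * (n : ℝ) ^ 2) * ip (lap Y w) (lap Y w)) • Y w) U :=
    (contDiffOn_const.fun_smul h.smooth_lap).sub
      ((contDiffOn_const.mul (contDiffOn_ip h.smooth_lap h.smooth_lap)).fun_smul h.smooth)
  exact h1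

theorem smooth_curvature (l k i j : Fin n) :
    ContDiffOn ℝ ∞ (curvature (inducedMetric Y) l k i j) U :=
  ((contDiffOn_pd h.isOpen (h.smooth_christoffel l j k) i).sub
    (contDiffOn_pd h.isOpen (h.smooth_christoffel l i k) j)).add
    (ContDiffOn.sum fun m _ => ((h.smooth_christoffel l i m).mul (h.smooth_christoffel m j k)).sub
      ((h.smooth_christoffel l j m).mul (h.smooth_christoffel m i k)))

theorem smooth_scalarCurvature : ContDiffOn ℝ ∞ (scalarCurvature (inducedMetric Y)) U :=
  ContDiffOn.sum fun k _ => ContDiffOn.sum fun j _ => (h.smooth_inv k j).mul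
    (ContDiffOn.sum fun i _ => h.smooth_curvature i k i j)

theorem diff (hu : u ∈ U) : DifferentiableAt ℝ Y u :=
  differentiableAt_of_contDiffOn h.isOpen hu h.smooth

theorem diff_pd (hu : u ∈ U) (i : Fin n) : DifferentiableAt ℝ (pd i Y) u :=
  differentiableAt_of_contDiffOn h.isOpen hu (h.smooth_pd i)

theorem diff_pd_pd (hu : u ∈ U) (i j : Fin n) : DifferentiableAt ℝ (pd i (pd j Y)) u :=
  differentiableAt_of_contDiffOn h.isOpen hu (h.smooth_pd_pd i j)

theorem diff_metric (hu : u ∈ U) (i j : Fin n) :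
    DifferentiableAt ℝ (fun w => inducedMetric Y w i j) u :=
  differentiableAt_of_contDiffOn h.isOpen hu (h.smooth_metric i j)

theorem diff_christoffel (hu : u ∈ U) (k i j : Fin n) :
    DifferentiableAt ℝ (christoffel (inducedMetric Y) k i j) u :=
  differentiableAt_of_contDiffOn h.isOpen hu (h.smooth_christoffel k i j)

/-! ### Inner products within the moving frame -/

theorem pd_pd_comm (hu : u ∈ U) (i j : Fin n) : pd i (pd j Y) u = pd j (pd i Y) u :=
  pd_comm h.isOpen hu h.smooth i j

theorem ip_self_pd (hu : u ∈ U) (i : Fin n) : ip (Y u) (pd i Y u) = 0 := by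
  have h1 := pd_ip (h.diff hu) (h.diff hu) i
  rw [pd_congr_of_eqOn h.isOpen hu h.null, pd_const, ip_comm (pd i Y u)] at h1
  linarith

theorem ip_pd_pd_self (hu : u ∈ U) (i j : Fin n) :
    ip (pd i (pd j Y) u) (Y u) = -inducedMetric Y u i j := by
  have h1 := pd_ip (h.diff hu) (h.diff_pd hu j) i
  rw [pd_congr_of_eqOn h.isOpen hu (fun w hw => h.ip_self_pd hw j), pd_const,
    ip_comm (Y u)] at h1
  rw [inducedMetric_apply]
  linarith

theorem pd_metric (hu : u ∈ U) (k i j : Fin n) :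
    pd k (fun w => inducedMetric Y w i j) u
      = ip (pd k (pd i Y) u) (pd j Y u) + ip (pd i Y u) (pd k (pd j Y) u) :=
  pd_ip (h.diff_pd hu i) (h.diff_pd hu j) k

/-- Koszul formula: the product rule writes the three metric derivatives through second derivatives
of $Y$, whose symmetry leaves twice $\langle\partial_i\partial_jY,\partial_lY\rangle$. -/
theorem christoffel_eq (hu : u ∈ U) (k i j : Fin n) :
    christoffel (inducedMetric Y) k i j u
      = ∑ l, (inducedMetric Y u)⁻¹ k l * ip (pd i (pd j Y) u) (pd l Y u) := by
  rw [christoffel, Finset.mul_sum]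
  refine Finset.sum_congr rfl fun l _ => ?_
  rw [h.pd_metric hu, h.pd_metric hu, h.pd_metric hu, h.pd_pd_comm hu j i, h.pd_pd_comm hu l i,
    h.pd_pd_comm hu l j, ip_comm (pd j Y u)]
  ring

/-- The lowered Christoffel symbols are `⟨∂_i ∂_k Y, ∂_m Y⟩`. -/
theorem metric_mul_christoffelMat (hu : u ∈ U) (i m k : Fin n) :
    (inducedMetric Y u * christoffelMat Y i u) m k = ip (pd i (pd k Y) u) (pd m Y u) := by
  have h1 : christoffelMat Y i u = (inducedMetric Y u)⁻¹ *
      Matrix.of fun m k => ip (pd i (pd k Y) u) (pd m Y u) := by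
    ext l k
    simp only [christoffelMat, Matrix.of_apply, Matrix.mul_apply, h.christoffel_eq hu]
  rw [h1, ← Matrix.mul_assoc, h.mul_inv hu, Matrix.one_mul, Matrix.of_apply]

/-- The Christoffel sum is exactly the tangential part of $\partial_i\partial_jY$, and it has been
subtracted. -/
theorem ip_secondCov_pd (hu : u ∈ U) (i j l : Fin n) :
    ip (secondCov Y i j u) (pd l Y u) = 0 := by
  rw [secondCov, ip_sub_left, ip_sum_left, ← h.metric_mul_christoffelMat hu, Matrix.mul_apply,
    sub_eq_zero]
  refine Finset.sum_congr rfl fun k _ => ?_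
  rw [ip_smul_left, ip_comm, inducedMetric_apply, mul_comm]
  rfl

-- The Christoffel correction is tangential and invisible to a normal $\nu$. This is why plain
-- second derivatives suffice to define $\mathbb A$ and $\mathbb B$.
omit h in
theorem _root_.ConformalGeometry.ip_secondCov {ν : Fin (n + 1 + 2) → ℝ} (hν : ∀ k, ip ν (pd k Y u) = 0)
    (i j : Fin n) : ip (secondCov Y i j u) ν = ip (pd i (pd j Y) u) ν := by
  rw [secondCov, ip_sub_left, ip_sum_left, Finset.sum_eq_zero, sub_zero]
  intro k _
  rw [ip_smul_left, ip_comm, hν, mul_zero]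

theorem ip_secondCov_self (hu : u ∈ U) (i j : Fin n) :
    ip (secondCov Y i j u) (Y u) = -inducedMetric Y u i j := by
  rw [ip_secondCov (h.ip_self_pd hu), h.ip_pd_pd_self hu]

theorem ip_lap_pd (hu : u ∈ U) (l : Fin n) : ip (lap Y u) (pd l Y u) = 0 := by
  simp only [lap_eq, ip_sum_left, ip_smul_left, h.ip_secondCov_pd hu, mul_zero,
    Finset.sum_const_zero]

theorem ip_lap_self (hu : u ∈ U) : ip (lap Y u) (Y u) = -n := by
  simp only [lap_eq, ip_sum_left, ip_smul_left, h.ip_secondCov_self hu]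
  have h1 : ((inducedMetric Y u)⁻¹ * (inducedMetric Y u)ᵀ).trace = n := by
    rw [inducedMetric_transpose, h.inv_mul hu, Matrix.trace_one, Fintype.card_fin]
  rw [← h1]
  simp only [Matrix.trace, Matrix.diag_apply, Matrix.mul_apply, Matrix.transpose_apply, mul_neg,
    Finset.sum_neg_distrib]

theorem ip_lap {ν : Fin (n + 1 + 2) → ℝ} (hu : u ∈ U) (hν : ∀ k, ip ν (pd k Y u) = 0) :
    ip (lap Y u) ν = -((inducedMetric Y u)⁻¹ * conformalSecondForm Y ν u).trace := by
  simp only [lap_eq, ip_sum_left, ip_smul_left, ip_secondCov hν, Matrix.trace,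
    Matrix.diag_apply, Matrix.mul_apply, conformalSecondForm, Matrix.of_apply, mul_neg,
    Finset.sum_neg_distrib, neg_neg]
  exact Finset.sum_congr rfl fun i _ => Finset.sum_congr rfl fun j _ => by rw [h.pd_pd_comm hu]

theorem conformalSecondForm_transpose (hu : u ∈ U) (ν : Fin (n + 1 + 2) → ℝ) :
    (conformalSecondForm Y ν u)ᵀ = conformalSecondForm Y ν u := by
  ext i j
  simp only [conformalSecondForm, Matrix.transpose_apply, Matrix.of_apply, h.pd_pd_comm hu j i]

theorem ip_conformalN_pd (hu : u ∈ U) (l : Fin n) : ip (conformalN Y u) (pd l Y u) = 0 := by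
  rw [conformalN, ip_sub_left, ip_smul_left, ip_smul_left, h.ip_lap_pd hu, h.ip_self_pd hu]
  ring

/-- The coefficient $-1/n$ in $N$ compensates $\langle\Delta Y,Y\rangle=-n$; the multiple of $Y$ is
null and only serves to make $N$ null. -/
theorem ip_conformalN_self (hn : n ≠ 0) (hu : u ∈ U) : ip (conformalN Y u) (Y u) = 1 := by
  have : (n : ℝ) ≠ 0 := Nat.cast_ne_zero.2 hn
  rw [conformalN, ip_sub_left, ip_smul_left, ip_smul_left, h.ip_lap_self hu, h.null u hu]
  field_simp
  ring

theorem ip_conformalN_conformalN (hn : n ≠ 0) (hu : u ∈ U) :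
    ip (conformalN Y u) (conformalN Y u) = 0 := by
  have : (n : ℝ) ≠ 0 := Nat.cast_ne_zero.2 hn
  simp only [conformalN, ip_sub_left, ip_sub_right, ip_smul_left, ip_smul_right, h.ip_lap_self hu,
    ip_comm (Y u) (lap Y u), h.null u hu]
  field_simp
  ring

end IsSpacelikeLift

/-! ### Normal frames and the Gauss equation -/

/-- `N` and `ξ` complete `Y` and `dY` to a frame of the ambient space with standard inner
products. -/
structure IsNormalFrame (Y : EuclideanSpace ℝ (Fin n) → Fin (n + 1 + 2) → ℝ)
    (u : EuclideanSpace ℝ (Fin n)) (N ξ : Fin (n + 1 + 2) → ℝ) : Prop where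
  null : ip N N = 0
  ip_lift : ip N (Y u) = 1
  orth_pd : ∀ k, ip N (pd k Y u) = 0
  unit : ip ξ ξ = -1
  normal_lift : ip ξ (Y u) = 0
  normal_N : ip ξ N = 0
  normal_pd : ∀ k, ip ξ (pd k Y u) = 0

theorem IsSpacelikeLift.isNormalFrame (h : IsSpacelikeLift U Y) (hn : n ≠ 0) (hu : u ∈ U)
    {ξ : Fin (n + 1 + 2) → ℝ} (hξ : IsConformalNormal Y u ξ) :
    IsNormalFrame Y u (conformalN Y u) ξ :=
  ⟨h.ip_conformalN_conformalN hn hu, h.ip_conformalN_self hn hu, h.ip_conformalN_pd hu,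
    hξ.unit, hξ.orth_lift, hξ.orth_N, hξ.orth_tangent⟩

/-- Every unit normal vector orthogonal to `Y` and `dY` is part of a normal frame. -/
theorem IsSpacelikeLift.exists_isNormalFrame (h : IsSpacelikeLift U Y) (hn : n ≠ 0) (hu : u ∈ U)
    {ξ : Fin (n + 1 + 2) → ℝ} (h1 : ip ξ ξ = -1) (h2 : ip ξ (Y u) = 0)
    (h3 : ∀ k, ip ξ (pd k Y u) = 0) : ∃ N, IsNormalFrame Y u N ξ := by
  set N₀ := conformalN Y u
  set α := ip N₀ ξ with hα
  have e1 : ip ξ N₀ = α := ip_comm _ _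
  have e2 : ip (Y u) N₀ = 1 := (ip_comm _ _).trans (h.ip_conformalN_self hn hu)
  have e3 : ip (Y u) ξ = 0 := (ip_comm _ _).trans h2
  -- A null rotation fixing $Y$: the term $\alpha\xi$ removes the $\xi$-component of $N_0$, since
  -- $\langle\xi,\xi\rangle=-1$, and $-\frac{\alpha^2}2Y$ restores nullity.
  refine ⟨N₀ + α • ξ - (α ^ 2 / 2) • Y u, ?_, ?_, fun k => ?_, h1, h2, ?_, h3⟩
  · simp only [ip_sub_left, ip_sub_right, ip_add_left, ip_add_right, ip_smul_left, ip_smul_right,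
      h1, h2, e1, e2, e3, ← hα, h.null u hu, h.ip_conformalN_self hn hu,
      h.ip_conformalN_conformalN hn hu, N₀]
    ring
  · simp only [ip_sub_left, ip_add_left, ip_smul_left, h2, h.null u hu,
      h.ip_conformalN_self hn hu, N₀]
    ring
  · simp only [ip_sub_left, ip_add_left, ip_smul_left, h3, h.ip_self_pd hu,
      h.ip_conformalN_pd hu, N₀]
    ring
  · simp only [ip_sub_right, ip_add_right, ip_smul_right, h1, h2, e1]
    ring

namespace IsNormalFrame

variable {N ξ : Fin (n + 1 + 2) → ℝ}

/-- The expansion of a vector in a normal frame. -/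
theorem expand (hN : IsNormalFrame Y u N ξ) (h : IsSpacelikeLift U Y) (hu : u ∈ U)
    (v : Fin (n + 1 + 2) → ℝ) :
    v = ip v N • Y u + ip v (Y u) • N - ip v ξ • ξ
      + ∑ i, (∑ j, (inducedMetric Y u)⁻¹ i j * ip v (pd j Y u)) • pd i Y u := by
  -- `L` takes inner products with the frame and `S` below is an explicit right inverse. Both spaces
  -- have dimension $n+3$, so `L` is injective and no separate proof of linear independence is
  -- needed.
  let L : (Fin (n + 1 + 2) → ℝ) →ₗ[ℝ] ℝ × ℝ × ℝ × (Fin n → ℝ) :=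
    { toFun := fun v => (ip v N, ip v (Y u), ip v ξ, fun j => ip v (pd j Y u))
      map_add' := fun v w => by simp only [ip_add_left]; rfl
      map_smul' := fun c v => by simp only [ip_smul_left]; rfl }
  have hdim : Module.finrank ℝ (Fin (n + 1 + 2) → ℝ)
      = Module.finrank ℝ (ℝ × ℝ × ℝ × (Fin n → ℝ)) := by
    simp only [Module.finrank_prod, Module.finrank_fintype_fun_eq_card, Fintype.card_fin,
      Module.finrank_self]
    omega
  have e0 : ip (Y u) N = 1 := (ip_comm _ _).trans hN.ip_lift
  have e1 : ip (Y u) ξ = 0 := (ip_comm _ _).trans hN.normal_lift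
  have e2 : ip N ξ = 0 := (ip_comm _ _).trans hN.normal_N
  have e3 : ∀ k, ip (pd k Y u) N = 0 := fun k => (ip_comm _ _).trans (hN.orth_pd k)
  have e4 : ∀ k, ip (pd k Y u) ξ = 0 := fun k => (ip_comm _ _).trans (hN.normal_pd k)
  have e5 : ∀ k, ip (pd k Y u) (Y u) = 0 := fun k => (ip_comm _ _).trans (h.ip_self_pd hu k)
  have hsum : ∀ (s : Fin n → ℝ) (k : Fin n),
      ∑ i, (∑ j, (inducedMetric Y u)⁻¹ i j * s j) * ip (pd i Y u) (pd k Y u) = s k := by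
    intro s k
    have h1 : (inducedMetric Y u * (inducedMetric Y u)⁻¹) *ᵥ s = s := by
      rw [h.mul_inv hu, Matrix.one_mulVec]
    rw [← Matrix.mulVec_mulVec] at h1
    refine Eq.trans ?_ (congrFun h1 k)
    refine Finset.sum_congr rfl fun i _ => ?_
    rw [mul_comm, ip_comm]
    rfl
  let S : ℝ × ℝ × ℝ × (Fin n → ℝ) → Fin (n + 1 + 2) → ℝ := fun p =>
    p.1 • Y u + p.2.1 • N - p.2.2.1 • ξ
      + ∑ i, (∑ j, (inducedMetric Y u)⁻¹ i j * p.2.2.2 j) • pd i Y u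
  have hLS : ∀ p, L (S p) = p := by
    intro p
    refine Prod.ext ?_ (Prod.ext ?_ (Prod.ext ?_ (funext fun k => ?_)))
    · change ip (S p) N = _
      simp only [S, ip_add_left, ip_sub_left, ip_smul_left, ip_sum_left, e0, e3, hN.null,
        hN.normal_N, mul_zero, Finset.sum_const_zero]
      ring
    · change ip (S p) (Y u) = _
      simp only [S, ip_add_left, ip_sub_left, ip_smul_left, ip_sum_left, e5, h.null u hu,
        hN.ip_lift, hN.normal_lift, mul_zero, Finset.sum_const_zero]
      ring
    · change ip (S p) ξ = _
      simp only [S, ip_add_left, ip_sub_left, ip_smul_left, ip_sum_left, e1, e2, e4, hN.unit,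
        mul_zero, Finset.sum_const_zero]
      ring
    · change ip (S p) (pd k Y u) = _
      simp only [S, ip_add_left, ip_sub_left, ip_smul_left, ip_sum_left, h.ip_self_pd hu,
        hN.orth_pd, hN.normal_pd, hsum, mul_zero]
      ring
  have hinj : Function.Injective L :=
    (LinearMap.injective_iff_surjective_of_finrank_eq_finrank hdim).2 fun p => ⟨S p, hLS p⟩
  exact hinj (hLS (L v)).symm

/-- The tangential sum in `expand` is orthogonal to $w$, so only the null pair $(Y,N)$ and the
time-like $\xi$ contribute. -/
theorem ip_eq (hN : IsNormalFrame Y u N ξ) (h : IsSpacelikeLift U Y) (hu : u ∈ U)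
    {v w : Fin (n + 1 + 2) → ℝ} (hw : ∀ k, ip w (pd k Y u) = 0) :
    ip v w = ip v N * ip w (Y u) + ip v (Y u) * ip w N - ip v ξ * ip w ξ := by
  conv_lhs => rw [hN.expand h hu v]
  rw [ip_add_left, ip_sub_left, ip_add_left, ip_smul_left, ip_smul_left, ip_smul_left, ip_sum_left,
    Finset.sum_eq_zero (fun i _ => by rw [ip_smul_left, ip_comm, hw, mul_zero]),
    ip_comm (Y u), ip_comm N, ip_comm ξ, add_zero]

/-- Here `conformalSecondForm Y N` plays the role of the Blaschke tensor for an arbitrary admissible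
$N$. This freedom allows any unit normal $\xi$ in `conformalFactor_eq`. -/
theorem ip_secondCov_secondCov (hN : IsNormalFrame Y u N ξ) (h : IsSpacelikeLift U Y) (hu : u ∈ U)
    (i j k l : Fin n) :
    ip (secondCov Y i j u) (secondCov Y k l u)
      = conformalSecondForm Y N u i j * inducedMetric Y u k l
        + inducedMetric Y u i j * conformalSecondForm Y N u k l
        - conformalSecondForm Y ξ u i j * conformalSecondForm Y ξ u k l := by
  rw [hN.ip_eq h hu (h.ip_secondCov_pd hu k l)]
  simp only [h.ip_secondCov_self hu, ip_secondCov hN.orth_pd, ip_secondCov hN.normal_pd,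
    conformalSecondForm, Matrix.of_apply]
  ring

end IsNormalFrame

namespace IsSpacelikeLift

variable (h : IsSpacelikeLift U Y)
include h

theorem diff_christoffelMat (hu : u ∈ U) (i l k : Fin n) :
    DifferentiableAt ℝ (fun w => christoffelMat Y i w l k) u := h.diff_christoffel hu l i k

/-- Metric compatibility $\nabla g=0$ in matrix form. -/
theorem pdMat_metric (hu : u ∈ U) (i : Fin n) :
    pdMat i (inducedMetric Y) u = inducedMetric Y u * christoffelMat Y i u
      + (christoffelMat Y i u)ᵀ * inducedMetric Y u := by
  have h1 : (christoffelMat Y i u)ᵀ * inducedMetric Y u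
      = (inducedMetric Y u * christoffelMat Y i u)ᵀ := by
    rw [Matrix.transpose_mul, inducedMetric_transpose]
  rw [h1]
  ext a b
  rw [Matrix.add_apply, Matrix.transpose_apply, h.metric_mul_christoffelMat hu,
    h.metric_mul_christoffelMat hu, pdMat_apply, h.pd_metric hu, ip_comm (pd a Y u), add_comm]

/-- The Gauss equation. -/
theorem gauss (hu : u ∈ U) (i j m k : Fin n) :
    (inducedMetric Y u * curvatureMat Y i j u) m k
      = ip (secondCov Y j k u) (secondCov Y i m u)
        - ip (secondCov Y i k u) (secondCov Y j m u) := by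
  have e1 : ∀ a b : Fin n, pdMat a (fun w => inducedMetric Y w * christoffelMat Y b w) u m k
      = ip (pd a (pd b (pd k Y)) u) (pd m Y u) + ip (pd b (pd k Y) u) (pd a (pd m Y) u) := by
    intro a b
    rw [pdMat_apply, pd_congr_of_eqOn h.isOpen hu
      (fun w hw => h.metric_mul_christoffelMat hw b m k), pd_ip (h.diff_pd_pd hu b k)
      (h.diff_pd hu m)]
  have e2 : ∀ a b : Fin n, pdMat a (fun w => inducedMetric Y w * christoffelMat Y b w) u
      = inducedMetric Y u * christoffelMat Y a u * christoffelMat Y b u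
        + (christoffelMat Y a u)ᵀ * (inducedMetric Y u * christoffelMat Y b u)
        + inducedMetric Y u * pdMat a (christoffelMat Y b) u := by
    intro a b
    rw [pdMat_mul (h.diff_metric hu) (h.diff_christoffelMat hu b), h.pdMat_metric hu, add_mul,
      Matrix.mul_assoc (christoffelMat Y a u)ᵀ]
  have e3 : ∀ a b : Fin n, ip (secondCov Y b k u) (secondCov Y a m u)
      = ip (pd b (pd k Y) u) (pd a (pd m Y) u)
        - ((christoffelMat Y a u)ᵀ * (inducedMetric Y u * christoffelMat Y b u)) m k := by
    intro a b
    rw [ip_secondCov (h.ip_secondCov_pd hu a m), secondCov, ip_sub_right, ip_sum_right,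
      Matrix.mul_apply]
    simp only [ip_smul_right, h.metric_mul_christoffelMat hu]
    rfl
  -- Differentiating $G\Gamma_j$ instead of $\Gamma_j$ avoids derivatives of $G^{-1}$.
  -- Antisymmetrizing in $i,j$ then cancels the third derivatives of $Y$.
  have e4 : inducedMetric Y u * curvatureMat Y i j u
      = pdMat i (fun w => inducedMetric Y w * christoffelMat Y j w) u
        - pdMat j (fun w => inducedMetric Y w * christoffelMat Y i w) u
        - (christoffelMat Y i u)ᵀ * (inducedMetric Y u * christoffelMat Y j u)
        + (christoffelMat Y j u)ᵀ * (inducedMetric Y u * christoffelMat Y i u) := by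
    rw [e2, e2, curvatureMat_eq]
    noncomm_ring
  rw [e4, e3, e3, Matrix.add_apply, Matrix.sub_apply, Matrix.sub_apply, e1, e1,
    pd_comm h.isOpen hu (h.smooth_pd k) i j]
  ring

end IsSpacelikeLift

/-! ### The conformal factor -/

/-- The factor `n² κ - ⟨ΔY, ΔY⟩` of the conformal metric. -/
def conformalFactor (Y : EuclideanSpace ℝ (Fin n) → Fin (n + 1 + 2) → ℝ)
    (u : EuclideanSpace ℝ (Fin n)) : ℝ :=
  (n : ℝ) ^ 2 * normalizedScalarCurvature (inducedMetric Y) u - ip (lap Y u) (lap Y u)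

theorem conformalMetric_eq (Y : EuclideanSpace ℝ (Fin n) → Fin (n + 1 + 2) → ℝ)
    (u : EuclideanSpace ℝ (Fin n)) :
    conformalMetric Y u = conformalFactor Y u • inducedMetric Y u := rfl

theorem sum_eq_trace {S : Matrix (Fin n) (Fin n) ℝ} (hS : Sᵀ = S) (X Z : Matrix (Fin n) (Fin n) ℝ) :
    ∑ k, ∑ j, S k j * ∑ i, ∑ m, S i m * (X i k * Z j m) = (X * S * Z * S).trace := by
  have hS' : ∀ i m, S m i = S i m := fun i m => congrFun (congrFun hS i) m
  simp only [Matrix.trace, Matrix.diag_apply, Matrix.mul_apply, Finset.sum_mul, Finset.mul_sum]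
  calc _ = ∑ k, ∑ i, ∑ j, ∑ m, S k j * (S i m * (X i k * Z j m)) :=
        Finset.sum_congr rfl fun k _ => Finset.sum_comm
    _ = ∑ i, ∑ k, ∑ j, ∑ m, S k j * (S i m * (X i k * Z j m)) := Finset.sum_comm
    _ = ∑ i, ∑ k, ∑ m, ∑ j, S k j * (S i m * (X i k * Z j m)) :=
        Finset.sum_congr rfl fun i _ => Finset.sum_congr rfl fun k _ => Finset.sum_comm
    _ = ∑ i, ∑ m, ∑ k, ∑ j, S k j * (S i m * (X i k * Z j m)) :=
        Finset.sum_congr rfl fun i _ => Finset.sum_comm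
    _ = ∑ i, ∑ m, ∑ j, ∑ k, S k j * (S i m * (X i k * Z j m)) :=
        Finset.sum_congr rfl fun i _ => Finset.sum_congr rfl fun m _ => Finset.sum_comm
    _ = _ := Finset.sum_congr rfl fun i _ => Finset.sum_congr rfl fun m _ =>
        Finset.sum_congr rfl fun j _ => Finset.sum_congr rfl fun k _ => by rw [hS' i m]; ring

namespace IsSpacelikeLift

variable (h : IsSpacelikeLift U Y)
include h

theorem smooth_conformalFactor : ContDiffOn ℝ ∞ (conformalFactor Y) U :=
  (contDiffOn_const.mul (h.smooth_scalarCurvature.div_const _)).sub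
    (contDiffOn_ip h.smooth_lap h.smooth_lap)

/-- The first Gauss term contracts to $\langle\Delta Y,\Delta Y\rangle$, the second to
$2\operatorname{tr}A-|B|^2$. -/
theorem scalarCurvature_eq (hu : u ∈ U) {N ξ : Fin (n + 1 + 2) → ℝ} (hN : IsNormalFrame Y u N ξ) :
    scalarCurvature (inducedMetric Y) u = ip (lap Y u) (lap Y u)
      - 2 * ((inducedMetric Y u)⁻¹ * conformalSecondForm Y N u).trace
      + ((inducedMetric Y u)⁻¹ * conformalSecondForm Y ξ u
        * ((inducedMetric Y u)⁻¹ * conformalSecondForm Y ξ u)).trace := by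
  set S := (inducedMetric Y u)⁻¹ with hSdef
  set A := conformalSecondForm Y N u
  set B := conformalSecondForm Y ξ u
  have hS : Sᵀ = S := inducedMetric_inv_transpose Y u
  have e1 : ∀ i j k, curvature (inducedMetric Y) i k i j u
      = ∑ m, S i m * (ip (secondCov Y j k u) (secondCov Y i m u)
        - ip (secondCov Y i k u) (secondCov Y j m u)) := by
    intro i j k
    have e0 : curvatureMat Y i j u = S * (inducedMetric Y u * curvatureMat Y i j u) := by
      rw [← Matrix.mul_assoc, h.inv_mul hu, Matrix.one_mul]
    change curvatureMat Y i j u i k = _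
    rw [e0, Matrix.mul_apply]
    exact Finset.sum_congr rfl fun m _ => by rw [h.gauss hu]
  have e2 : ∑ k, ∑ j, S k j * ∑ i, ∑ m, S i m * ip (secondCov Y j k u) (secondCov Y i m u)
      = ip (lap Y u) (lap Y u) := by
    rw [lap_eq, ip_sum_left, Finset.sum_comm]
    refine Finset.sum_congr rfl fun j _ => ?_
    rw [ip_sum_left]
    refine Finset.sum_congr rfl fun k _ => ?_
    have hkj : S k j = S j k := congrFun (congrFun hS j) k
    rw [ip_smul_left, hkj]
    simp only [ip_sum_right, ip_smul_right]
    rfl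
  have e3 : ∑ k, ∑ j, S k j * ∑ i, ∑ m, S i m * ip (secondCov Y i k u) (secondCov Y j m u)
      = 2 * (S * A).trace - (S * B * (S * B)).trace := by
    simp only [hN.ip_secondCov_secondCov h hu, mul_sub, mul_add, Finset.sum_add_distrib,
      Finset.sum_sub_distrib]
    rw [sum_eq_trace hS, sum_eq_trace hS, sum_eq_trace hS]
    have t1 : (A * S * inducedMetric Y u * S).trace = (S * A).trace := by
      rw [Matrix.mul_assoc A, h.inv_mul hu, Matrix.mul_one, Matrix.trace_mul_comm]
    have t2 : (inducedMetric Y u * S * A * S).trace = (S * A).trace := by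
      rw [h.mul_inv hu, Matrix.one_mul, Matrix.trace_mul_comm]
    have t3 : (B * S * B * S).trace = (S * B * (S * B)).trace := by
      rw [Matrix.trace_mul_comm (B * S * B), Matrix.mul_assoc S B, Matrix.mul_assoc B S B]
    rw [t1, t2, t3]
    ring
  calc scalarCurvature (inducedMetric Y) u
      = ∑ k, ∑ j, S k j * ∑ i, ∑ m, S i m * (ip (secondCov Y j k u) (secondCov Y i m u)
        - ip (secondCov Y i k u) (secondCov Y j m u)) := by
        simp only [scalarCurvature, e1, ← hSdef]
    _ = _ := by
        simp only [mul_sub, Finset.sum_sub_distrib]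
        rw [e2, e3]
        ring

/-- $\Delta Y$ is normal, with inner products $-n$, $-\operatorname{tr}A$, $-\operatorname{tr}B$
against $Y$, $N$, $\xi$. -/
theorem ip_lap_lap (hu : u ∈ U) {N ξ : Fin (n + 1 + 2) → ℝ} (hN : IsNormalFrame Y u N ξ) :
    ip (lap Y u) (lap Y u)
      = 2 * n * ((inducedMetric Y u)⁻¹ * conformalSecondForm Y N u).trace
        - ((inducedMetric Y u)⁻¹ * conformalSecondForm Y ξ u).trace ^ 2 := by
  rw [hN.ip_eq h hu (h.ip_lap_pd hu), h.ip_lap_self hu, h.ip_lap hu hN.orth_pd,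
    h.ip_lap hu hN.normal_pd]
  ring

/-- The conformal factor in terms of the trace-free part of the second fundamental form in the
direction of any unit normal vector. -/
theorem conformalFactor_eq (hn : 2 ≤ n) (hu : u ∈ U) {ξ : Fin (n + 1 + 2) → ℝ}
    (h1 : ip ξ ξ = -1) (h2 : ip ξ (Y u) = 0) (h3 : ∀ k, ip ξ (pd k Y u) = 0) :
    conformalFactor Y u = n / (n - 1) *
      (((inducedMetric Y u)⁻¹ * conformalSecondForm Y ξ u
        * ((inducedMetric Y u)⁻¹ * conformalSecondForm Y ξ u)).trace
      - ((inducedMetric Y u)⁻¹ * conformalSecondForm Y ξ u).trace ^ 2 / n) := by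
  obtain ⟨N, hN⟩ := h.exists_isNormalFrame (by omega) hu h1 h2 h3
  have hn' : (2 : ℝ) ≤ n := by exact_mod_cast hn
  have n0 : (n : ℝ) ≠ 0 := by linarith
  have n1 : (n : ℝ) - 1 ≠ 0 := by linarith
  -- Since $n^2\kappa$ is $\frac n{n-1}$ times the scalar curvature, $\operatorname{tr}A$ cancels
  -- and with it the choice of $N$.
  rw [conformalFactor, normalizedScalarCurvature, h.scalarCurvature_eq hu hN, h.ip_lap_lap hu hN]
  field_simp
  ring

end IsSpacelikeLift

end StructureEquations

/-! ### Linear algebra -/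

section LinearAlgebra

variable {n : ℕ}

/-- Factor $G=Q^{\mathsf T}Q$ and take $P=Q^{-1}$, whose columns are $G$-orthonormal. Forms become
$P^{\mathsf T}XP$, which reduces $G$-self-adjoint operators to symmetric matrices. -/
theorem exists_orthonormalizing {G : Matrix (Fin n) (Fin n) ℝ} (hG : G.PosDef) :
    ∃ P : Matrix (Fin n) (Fin n) ℝ, Pᵀ * G * P = 1 ∧ G⁻¹ = P * Pᵀ := by
  open scoped MatrixOrder in
  obtain ⟨Q, hQ⟩ := CStarAlgebra.nonneg_iff_eq_star_mul_self.1 hG.posSemidef.nonneg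
  rw [Matrix.star_eq_conjTranspose, Matrix.conjTranspose_eq_transpose_of_trivial] at hQ
  have hdet : Q.det ≠ 0 := by
    intro h0
    have h1 := hG.det_pos
    rw [hQ, Matrix.det_mul, h0, mul_zero] at h1
    exact lt_irrefl _ h1
  have hu : IsUnit Q.det := hdet.isUnit
  refine ⟨Q⁻¹, ?_, ?_⟩
  · rw [hQ, Matrix.transpose_nonsing_inv, ← Matrix.mul_assoc,
      Matrix.nonsing_inv_mul _ (by rwa [Matrix.det_transpose]), Matrix.one_mul,
      Matrix.mul_nonsing_inv _ hu]
  · rw [hQ, Matrix.mul_inv_rev, Matrix.transpose_nonsing_inv]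

theorem trace_mul_self_nonneg {X : Matrix (Fin n) (Fin n) ℝ} (hX : Xᵀ = X) :
    0 ≤ (X * X).trace := by
  simp only [Matrix.trace, Matrix.diag_apply, Matrix.mul_apply]
  refine Finset.sum_nonneg fun i _ => Finset.sum_nonneg fun j _ => ?_
  have hij : X j i = X i j := congrFun (congrFun hX i) j
  rw [hij]
  exact mul_self_nonneg _

/-- The square of the norm of a symmetric form with respect to a positive definite metric is
nonnegative. -/
theorem trace_inv_mul_sq_nonneg {G B : Matrix (Fin n) (Fin n) ℝ} (hG : G.PosDef) (hB : Bᵀ = B) :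
    0 ≤ (G⁻¹ * B * (G⁻¹ * B)).trace := by
  obtain ⟨P, -, hP⟩ := exists_orthonormalizing hG
  have h1 : (G⁻¹ * B * (G⁻¹ * B)).trace = ((Pᵀ * B * P) * (Pᵀ * B * P)).trace := by
    rw [hP, Matrix.trace_mul_comm (Pᵀ * B * P)]
    have e1 : P * Pᵀ * B * (P * Pᵀ * B) = P * (Pᵀ * B * P * (Pᵀ * B)) := by
      simp only [Matrix.mul_assoc]
    rw [e1, Matrix.trace_mul_comm P]
    simp only [Matrix.mul_assoc]
  rw [h1]
  refine trace_mul_self_nonneg ?_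
  rw [Matrix.transpose_mul, Matrix.transpose_mul, Matrix.transpose_transpose, hB, Matrix.mul_assoc]

/-- Commuting symmetric operators have a common orthonormal eigenbasis. -/
theorem exists_common_orthonormal_eigenbasis {E : Type*} [NormedAddCommGroup E]
    [InnerProductSpace ℝ E] [FiniteDimensional ℝ E] (hE : Module.finrank ℝ E = n)
    {T S : E →ₗ[ℝ] E} (hT : T.IsSymmetric) (hS : S.IsSymmetric) (hTS : Commute T S) :
    ∃ (v : OrthonormalBasis (Fin n) ℝ E) (a b : Fin n → ℝ),
      (∀ i, T (v i) = a i • v i) ∧ ∀ i, S (v i) = b i • v i := by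
  classical
  have hinv : ∀ μ : Module.End.Eigenvalues T, ∀ x ∈ Module.End.eigenspace T (μ : ℝ),
      S x ∈ Module.End.eigenspace T (μ : ℝ) := by
    intro μ x hx
    rw [Module.End.mem_eigenspace_iff] at hx ⊢
    have h1 : T (S x) = S (T x) := LinearMap.congr_fun hTS x
    rw [h1, hx, map_smul]
  -- `S` preserves each eigenspace of `T`, so it is diagonalized there and the bases are collected
  -- over the orthogonal sum.
  let fam : (μ : Module.End.Eigenvalues T) → OrthonormalBasis
      (Fin (Module.finrank ℝ (Module.End.eigenspace T (μ : ℝ)))) ℝ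
      (Module.End.eigenspace T (μ : ℝ)) :=
    fun μ => (hS.restrict_invariant (hinv μ)).eigenvectorBasis rfl
  let w := hT.direct_sum_isInternal.collectedOrthonormalBasis hT.orthogonalFamily_eigenspaces' fam
  have hcard : Fintype.card (Σ μ : Module.End.Eigenvalues T,
      Fin (Module.finrank ℝ (Module.End.eigenspace T (μ : ℝ)))) = n := by
    rw [← hE, Module.finrank_eq_card_basis w.toBasis]
  let σ := Fintype.equivFinOfCardEq hcard
  have hw : ∀ p, w p = (fam p.1 p.2 : E) := by
    intro p
    simp [w, DirectSum.IsInternal.collectedOrthonormalBasis]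
  refine ⟨w.reindex σ, fun i => ((σ.symm i).1 : ℝ), fun i =>
    (hS.restrict_invariant (hinv (σ.symm i).1)).eigenvalues rfl (σ.symm i).2, fun i => ?_,
    fun i => ?_⟩
  · rw [OrthonormalBasis.reindex_apply, hw]
    exact Module.End.mem_eigenspace_iff.1 (fam _ _).2
  · rw [OrthonormalBasis.reindex_apply, hw]
    have h1 := (hS.restrict_invariant (hinv (σ.symm i).1)).apply_eigenvectorBasis rfl (σ.symm i).2
    exact congrArg Subtype.val h1

/-- Symmetric forms whose operators commute have a common orthonormal eigenbasis with respect to a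
positive definite metric. -/
theorem exists_common_eigenbasis {G A B : Matrix (Fin n) (Fin n) ℝ} (hG : G.PosDef)
    (hA : Aᵀ = A) (hB : Bᵀ = B) (hAB : Commute (G⁻¹ * A) (G⁻¹ * B)) :
    ∃ (e : Fin n → Fin n → ℝ) (a b : Fin n → ℝ),
      (∀ i j, e i ⬝ᵥ (G *ᵥ e j) = if i = j then 1 else 0) ∧
      (∀ i, (G⁻¹ * A) *ᵥ e i = a i • e i) ∧ ∀ i, (G⁻¹ * B) *ᵥ e i = b i • e i := by
  obtain ⟨P, hP1, hP2⟩ := exists_orthonormalizing hG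
  have hG1 : G * G⁻¹ = 1 := Matrix.mul_nonsing_inv _ hG.det_pos.ne'.isUnit
  have hcomm : A * G⁻¹ * B = B * G⁻¹ * A := by
    have h1 := congrArg (G * ·) hAB.eq
    simp only [← Matrix.mul_assoc, hG1, Matrix.one_mul] at h1
    exact h1
  have hsymm : ∀ {X : Matrix (Fin n) (Fin n) ℝ}, Xᵀ = X →
      (Matrix.toEuclideanLin (Pᵀ * X * P)).IsSymmetric := by
    intro X hX
    rw [Matrix.isSymmetric_toEuclideanLin_iff]
    change (Pᵀ * X * P)ᴴ = _
    rw [Matrix.conjTranspose_eq_transpose_of_trivial, Matrix.transpose_mul, Matrix.transpose_mul,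
      Matrix.transpose_transpose, hX, Matrix.mul_assoc]
  have hTS : Commute (Matrix.toEuclideanLin (Pᵀ * A * P)) (Matrix.toEuclideanLin (Pᵀ * B * P)) := by
    have h1 : Pᵀ * A * P * (Pᵀ * B * P) = Pᵀ * B * P * (Pᵀ * A * P) := by
      calc _ = Pᵀ * (A * (P * Pᵀ) * B) * P := by simp only [Matrix.mul_assoc]
        _ = Pᵀ * (B * (P * Pᵀ) * A) * P := by rw [← hP2, hcomm]
        _ = _ := by simp only [Matrix.mul_assoc]
    refine LinearMap.ext fun x => ?_
    simp only [Module.End.mul_apply, Matrix.toLpLin_apply, Matrix.mulVec_mulVec, h1]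
  obtain ⟨v, a, b, ha, hb⟩ := exists_common_orthonormal_eigenbasis
    (E := EuclideanSpace ℝ (Fin n)) (n := n) (by simp)
    (hsymm hA) (hsymm hB) hTS
  have heig : ∀ {X : Matrix (Fin n) (Fin n) ℝ} {c : ℝ} {i : Fin n},
      Matrix.toEuclideanLin (Pᵀ * X * P) (v i) = c • v i →
      (G⁻¹ * X) *ᵥ (P *ᵥ (v i).ofLp) = c • (P *ᵥ (v i).ofLp) := by
    intro X c i h
    have h1 : (Pᵀ * X * P) *ᵥ (v i).ofLp = c • (v i).ofLp := congrArg WithLp.ofLp h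
    rw [← Matrix.mulVec_smul, ← h1, Matrix.mulVec_mulVec, Matrix.mulVec_mulVec, hP2]
    simp only [Matrix.mul_assoc]
  refine ⟨fun i => P *ᵥ (v i).ofLp, a, b, fun i j => ?_, fun i => heig (ha i), fun i => heig (hb i)⟩
  have h1 : (P *ᵥ (v i).ofLp) ⬝ᵥ (G *ᵥ (P *ᵥ (v j).ofLp)) = (v i).ofLp ⬝ᵥ (v j).ofLp := by
    rw [← Matrix.vecMul_transpose, ← Matrix.dotProduct_mulVec, Matrix.mulVec_mulVec,
      Matrix.mulVec_mulVec, hP1, Matrix.one_mulVec]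
  rw [h1, ← orthonormal_iff_ite.1 v.orthonormal i j, EuclideanSpace.inner_eq_star_dotProduct,
    dotProduct_comm]
  simp

/-- The relation `a_i + a_j = b_i b_j` for `a_i ≠ a_j` allows at most three values of `a`. -/
theorem encard_range_le_three {a b : Fin n → ℝ}
    (h : ∀ i j, a i ≠ a j → a i + a j = b i * b j) : (Set.range a).encard ≤ 3 := by
  by_contra hlt
  rw [not_le] at hlt
  obtain ⟨t, hts, ht⟩ := Set.exists_subset_encard_eq (Order.add_one_le_of_lt hlt)
  have hfin : t.Finite := Set.finite_of_encard_eq_coe (k := 4) (by rw [ht]; rfl)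
  have hcard : hfin.toFinset.card = 4 := by
    have h1 := hfin.encard_eq_coe_toFinset_card
    rw [ht] at h1
    exact_mod_cast h1.symm
  let f := (hfin.toFinset.equivFinOfCardEq hcard).symm
  have hinj : ∀ p q : Fin 4, p ≠ q → (f p : ℝ) ≠ f q := fun p q hpq hf =>
    hpq (f.injective (Subtype.ext hf))
  have hmem : ∀ p : Fin 4, ∃ i, a i = f p := fun p =>
    hts (hfin.mem_toFinset.1 (f p).2)
  choose k hk using hmem
  have hne : ∀ p q : Fin 4, p ≠ q → a (k p) ≠ a (k q) := by
    intro p q hpq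
    rw [hk, hk]
    exact hinj p q hpq
  have h01 := h _ _ (hne 0 1 (by decide))
  have h23 := h _ _ (hne 2 3 (by decide))
  have h02 := h _ _ (hne 0 2 (by decide))
  have h13 := h _ _ (hne 1 3 (by decide))
  -- Both pairings of the four indices have product $b_0b_1b_2b_3$; the difference of the two left
  -- sides factors in this way.
  have key : (a (k 0) - a (k 3)) * (a (k 2) - a (k 1)) = 0 := by
    have e1 : (a (k 0) + a (k 1)) * (a (k 2) + a (k 3))
        = (a (k 0) + a (k 2)) * (a (k 1) + a (k 3)) := by
      rw [h01, h23, h02, h13]; ring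
    linarith
  rcases mul_eq_zero.1 key with h0 | h0
  · exact hne 0 3 (by decide) (sub_eq_zero.1 h0)
  · exact hne 2 1 (by decide) (sub_eq_zero.1 h0)

/-- If `a` takes three values, the relation `a_i + a_j = b_i b_j` makes `b` a function of `a`. -/
theorem eq_of_three_le_encard {a b : Fin n → ℝ}
    (h : ∀ i j, a i ≠ a j → a i + a j = b i * b j) (h3 : 3 ≤ (Set.range a).encard)
    {i j : Fin n} (hij : a i = a j) : b i = b j := by
  have h2 : 1 < (Set.range a \ {a i}).encard := by
    have h1 := Set.encard_sdiff_singleton_add_one (Set.mem_range_self (f := a) i)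
    rw [← h1] at h3
    by_contra hle
    rw [not_lt] at hle
    exact absurd (h3.trans (add_le_add_left hle 1)) (by decide)
  obtain ⟨x, y, ⟨⟨k, hk⟩, hx⟩, ⟨⟨l, hl⟩, hy⟩, hxy⟩ := Set.one_lt_encard_iff.1 h2
  subst hk hl
  have hx' : a i ≠ a k := fun e => hx e.symm
  have hy' : a i ≠ a l := fun e => hy e.symm
  by_contra hb
  -- If $b_i\ne b_j$, comparing the relations of $i$ and $j$ with $m$ forces $b_m=0$. Then $-a_i$ is
  -- the only other value of `a`, whereas `k` and `l` give two.
  have hbz : ∀ m, a i ≠ a m → a i + a m = 0 := by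
    intro m hm
    have e1 := h i m hm
    have e2 := h j m (hij ▸ hm)
    have e3 : (b i - b j) * b m = 0 := by linarith
    rcases mul_eq_zero.1 e3 with e4 | e4
    · exact absurd (sub_eq_zero.1 e4) hb
    · rw [e1, e4, mul_zero]
  exact hxy (by linarith [hbz k hx', hbz l hy'])

/-- A matrix with an eigenbasis that is orthonormal for some metric has the expected
characteristic polynomial. -/
theorem charpoly_of_eigenbasis {G T : Matrix (Fin n) (Fin n) ℝ} {e : Fin n → Fin n → ℝ}
    {a : Fin n → ℝ} (he : ∀ i j, e i ⬝ᵥ (G *ᵥ e j) = if i = j then 1 else 0)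
    (ha : ∀ i, T *ᵥ e i = a i • e i) :
    T.charpoly = ∏ i, (Polynomial.X - Polynomial.C (a i)) := by
  let Q : Matrix (Fin n) (Fin n) ℝ := Matrix.of fun i j => e j i
  have h1 : Qᵀ * G * Q = 1 := by
    ext i j
    rw [Matrix.one_apply, ← he i j, Matrix.mul_assoc, Matrix.mul_apply]
    rfl
  have h2 : T * Q = Q * Matrix.diagonal a := by
    ext i j
    rw [Matrix.mul_diagonal, Matrix.mul_apply]
    exact (congrFun (ha j) i).trans (mul_comm _ _)
  have h3 : Q * (Qᵀ * G) = 1 := mul_eq_one_comm.1 h1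
  have h4 : T = Q * Matrix.diagonal a * (Qᵀ * G) := by
    rw [← h2, Matrix.mul_assoc, h3, Matrix.mul_one]
  rw [h4, Matrix.mul_assoc, Matrix.charpoly_mul_comm, Matrix.mul_assoc, h1, Matrix.mul_one,
    Matrix.charpoly_diagonal]

/-- Makes the projection to the $n+1$ space-like coordinates injective on any subspace where the
form is nonnegative. -/
theorem ip_self_neg {v : Fin (n + 1 + 2) → ℝ} (hv : ∀ i : Fin (n + 1 + 2), 2 ≤ (i : ℕ) → v i = 0)
    (h0 : v ≠ 0) : ip v v < 0 := by
  obtain ⟨j, hj⟩ := Function.ne_iff.1 h0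
  have hterm : ∀ i : Fin (n + 1 + 2), (if (i : ℕ) < 2 then (-1 : ℝ) else 1) * v i * v i
      = -(v i * v i) := by
    intro i
    split_ifs with hi
    · ring
    · rw [hv i (not_lt.1 hi)]; ring
  simp only [ip, pseudoInner, hterm, Finset.sum_neg_distrib, neg_neg_iff_pos]
  exact Finset.sum_pos' (fun i _ => mul_self_nonneg _) ⟨j, Finset.mem_univ _, mul_self_pos.2 hj⟩

end LinearAlgebra

/-! ### Existence of conformal normal vectors -/

/-- By dimension some $\xi\ne0$ is orthogonal to $Y$, $N$, $dY$. It must be time-like, for otherwise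
$\xi$, $Y+N$, $dY$ would span a nonnegative subspace of dimension $n+2$ in signature $(2,n+1)$. -/
theorem IsSpacelikeLift.exists_isConformalNormal {n : ℕ} {U : Set (EuclideanSpace ℝ (Fin n))}
    {u : EuclideanSpace ℝ (Fin n)} {Y : EuclideanSpace ℝ (Fin n) → Fin (n + 1 + 2) → ℝ}
    (h : IsSpacelikeLift U Y) (hn : n ≠ 0) (hu : u ∈ U) : ∃ ξ, IsConformalNormal Y u ξ := by
  set N := conformalN Y u with hN
  let L : (Fin (n + 1 + 2) → ℝ) →ₗ[ℝ] ℝ × ℝ × (Fin n → ℝ) :=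
    { toFun := fun v => (ip v (Y u), ip v N, fun j => ip v (pd j Y u))
      map_add' := fun v w => by simp only [ip_add_left]; rfl
      map_smul' := fun c v => by simp only [ip_smul_left]; rfl }
  have hL : L.ker ≠ ⊥ := LinearMap.ker_ne_bot_of_finrank_lt (by
    simp only [Module.finrank_prod, Module.finrank_fintype_fun_eq_card, Fintype.card_fin,
      Module.finrank_self]
    omega)
  obtain ⟨ξ, hξ, hξ0⟩ := Submodule.exists_mem_ne_zero_of_ne_bot hL
  have hξ' : L ξ = 0 := hξ
  have h1 : ip ξ (Y u) = 0 := congrArg Prod.fst hξ'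
  have h2 : ip ξ N = 0 := congrArg (fun p => p.2.1) hξ'
  have h3 : ∀ k, ip ξ (pd k Y u) = 0 := fun k => congrFun (congrArg (fun p => p.2.2) hξ') k
  have hneg : ip ξ ξ < 0 := by
    by_contra hpos
    rw [not_lt] at hpos
    -- $Y+N$ is the space-like direction of the null pair, with $\langle Y+N,Y+N\rangle=2$. The
    -- source has dimension $n+2$ and there are $n+1$ space-like coordinates, hence a kernel.
    let c : ℝ × ℝ × (Fin n → ℝ) →ₗ[ℝ] (Fin (n + 1 + 2) → ℝ) :=
      { toFun := fun p => p.1 • ξ + p.2.1 • (Y u + N) + ∑ i, p.2.2 i • pd i Y u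
        map_add' := fun p q => by
          simp only [Prod.fst_add, Prod.snd_add, Pi.add_apply, add_smul, Finset.sum_add_distrib]
          abel
        map_smul' := fun r p => by
          simp only [Prod.smul_fst, Prod.smul_snd, Pi.smul_apply, smul_assoc, smul_add,
            Finset.smul_sum, RingHom.id_apply] }
    let pr : (Fin (n + 1 + 2) → ℝ) →ₗ[ℝ] ({i : Fin (n + 1 + 2) // 2 ≤ (i : ℕ)} → ℝ) :=
      LinearMap.funLeft ℝ ℝ Subtype.val
    have hcard : Fintype.card {i : Fin (n + 1 + 2) // 2 ≤ (i : ℕ)} < n + 2 := by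
      have h1 := Fintype.card_subtype_compl (fun i : Fin (n + 1 + 2) => (i : ℕ) < 2)
      have h2 : Fintype.card {i : Fin (n + 1 + 2) // (i : ℕ) < 2} = 2 := by
        have e : {i : Fin (n + 1 + 2) // (i : ℕ) < 2} ≃ Fin 2 :=
          { toFun := fun i => ⟨i.1, i.2⟩
            invFun := fun i => ⟨⟨i, by omega⟩, i.2⟩
            left_inv := fun i => rfl
            right_inv := fun i => rfl }
        rw [Fintype.card_congr e, Fintype.card_fin]
      simp only [not_lt, Fintype.card_fin, h2] at h1
      omega
    have hK : (pr ∘ₗ c).ker ≠ ⊥ := LinearMap.ker_ne_bot_of_finrank_lt (by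
      simp only [Module.finrank_prod, Module.finrank_fintype_fun_eq_card, Fintype.card_fin,
        Module.finrank_self]
      omega)
    obtain ⟨p, hp, hp0⟩ := Submodule.exists_mem_ne_zero_of_ne_bot hK
    have hip : ip (c p) (c p) = p.1 ^ 2 * ip ξ ξ + 2 * p.2.1 ^ 2
        + p.2.2 ⬝ᵥ (inducedMetric Y u *ᵥ p.2.2) := by
      have e1 : ip (Y u) ξ = 0 := (ip_comm _ _).trans h1
      have e2 : ip N ξ = 0 := (ip_comm _ _).trans h2
      have e3 : ∀ k, ip (pd k Y u) ξ = 0 := fun k => (ip_comm _ _).trans (h3 k)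
      have e4 : ∀ k, ip (pd k Y u) (Y u) = 0 := fun k => (ip_comm _ _).trans (h.ip_self_pd hu k)
      have e5 : ∀ k, ip (pd k Y u) N = 0 := fun k =>
        (ip_comm _ _).trans (h.ip_conformalN_pd hu k)
      have e6 : ip N (Y u) = 1 := h.ip_conformalN_self hn hu
      have e7 : ip (Y u) N = 1 := (ip_comm _ _).trans e6
      have e8 : p.2.2 ⬝ᵥ (inducedMetric Y u *ᵥ p.2.2)
          = ∑ i, p.2.2 i * ∑ j, p.2.2 j * ip (pd j Y u) (pd i Y u) := by
        refine Finset.sum_congr rfl fun i _ => ?_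
        simp only [Matrix.mulVec, dotProduct, inducedMetric_apply]
        congr 1
        exact Finset.sum_congr rfl fun j _ => by rw [ip_comm, mul_comm]
      have hNN : ip N N = 0 := h.ip_conformalN_conformalN hn hu
      have e9 : ∀ k, ip N (pd k Y u) = 0 := h.ip_conformalN_pd hu
      change ip (p.1 • ξ + p.2.1 • (Y u + N) + ∑ i, p.2.2 i • pd i Y u)
        (p.1 • ξ + p.2.1 • (Y u + N) + ∑ i, p.2.2 i • pd i Y u) = _
      simp only [ip_add_left, ip_add_right, ip_smul_left, ip_smul_right, ip_sum_left,
        ip_sum_right, h1, h2, h3, e1, e2, e3, e4, e5, e6, e7, e9, h.ip_self_pd hu, h.null u hu,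
        hNN, mul_zero, Finset.sum_const_zero, e8]
      ring_nf
    have hG : 0 ≤ p.2.2 ⬝ᵥ (inducedMetric Y u *ᵥ p.2.2) := by
      simpa using (h.posDef u hu).posSemidef.dotProduct_mulVec_nonneg p.2.2
    have hc0 : c p = 0 := by
      by_contra hne
      have := ip_self_neg (fun i hi => congrFun (show pr (c p) = 0 from hp) ⟨i, hi⟩) hne
      nlinarith [mul_nonneg (sq_nonneg p.1) hpos, sq_nonneg p.2.1]
    rw [hc0, ip_zero_left] at hip
    have hp1 : 0 ≤ p.1 ^ 2 * ip ξ ξ := mul_nonneg (sq_nonneg _) hpos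
    have hp2 : p.2.1 = 0 := by nlinarith [sq_nonneg p.2.1]
    have hp3 : p.2.2 = 0 := by
      by_contra hne
      have h4 := (h.posDef u hu).dotProduct_mulVec_pos hne
      rw [star_trivial] at h4
      nlinarith [sq_nonneg p.2.1]
    -- A null $\xi$ has not been excluded, so the quadratic form does not control `p.1`; it vanishes
    -- because $\xi\neq0$.
    have hp4 : p.1 • ξ = 0 := by
      have h5 : p.1 • ξ + p.2.1 • (Y u + N) + ∑ i, p.2.2 i • pd i Y u = 0 := hc0
      simpa [hp2, hp3] using h5
    exact hp0 (Prod.ext ((smul_eq_zero.1 hp4).resolve_right hξ0) (Prod.ext hp2 hp3))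
  set r := Real.sqrt (-ip ξ ξ) with hr
  have hr0 : r ≠ 0 := (Real.sqrt_pos.2 (neg_pos.2 hneg)).ne'
  have hr2 : r * r = -ip ξ ξ := Real.mul_self_sqrt (neg_pos.2 hneg).le
  refine ⟨r⁻¹ • ξ, ?_, ?_, ?_, fun k => ?_⟩
  · rw [ip_smul_left, ip_smul_right, ← neg_eq_iff_eq_neg.2 hr2]
    field_simp
  · rw [ip_smul_left, h1, mul_zero]
  · rw [ip_smul_left, h2, mul_zero]
  · rw [ip_smul_left, h3, mul_zero]

/-! ### Lifts with parallel Blaschke tensor -/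

namespace IsSpacelikeLift

variable {n : ℕ} {U : Set (EuclideanSpace ℝ (Fin n))} {u : EuclideanSpace ℝ (Fin n)}
  {Y : EuclideanSpace ℝ (Fin n) → Fin (n + 1 + 2) → ℝ} {ξ : Fin (n + 1 + 2) → ℝ}

/-- Being orthogonal to $Y$ and $N$, $\xi$ is orthogonal to $\Delta Y$, and $\langle\Delta
Y,\xi\rangle=-\operatorname{tr}B$. -/
theorem trace_secondFormOperator (h : IsSpacelikeLift U Y) (hn : n ≠ 0) (hu : u ∈ U)
    (hξ : IsConformalNormal Y u ξ) : (secondFormOperator Y ξ u).trace = 0 := by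
  have h1 : ip (lap Y u) ξ = 0 := by
    have h2 := hξ.orth_N
    rw [conformalN, ip_sub_right, ip_smul_right, ip_smul_right, hξ.orth_lift, mul_zero, sub_zero,
      ip_comm] at h2
    refine (mul_eq_zero.1 h2).resolve_left ?_
    exact neg_ne_zero.2 (one_div_ne_zero (Nat.cast_ne_zero.2 hn))
  rw [h.ip_lap hu hξ.orth_tangent, neg_eq_zero] at h1
  exact h1

/-- The squared norm of the conformal second fundamental form. -/
theorem conformalFactor_eq_of_isConformalNormal (h : IsSpacelikeLift U Y) (hn : 2 ≤ n) (hu : u ∈ U)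
    (hξ : IsConformalNormal Y u ξ) : conformalFactor Y u
      = n / (n - 1) * (secondFormOperator Y ξ u * secondFormOperator Y ξ u).trace := by
  rw [h.conformalFactor_eq hn hu hξ.unit hξ.orth_lift hξ.orth_tangent]
  have h1 := h.trace_secondFormOperator (by omega) hu hξ
  rw [secondFormOperator] at h1
  rw [h1, secondFormOperator]
  simp

theorem conformalFactor_nonneg (h : IsSpacelikeLift U Y) (hn : 2 ≤ n) (hu : u ∈ U) :
    0 ≤ conformalFactor Y u := by
  obtain ⟨ξ, hξ⟩ := h.exists_isConformalNormal (by omega) hu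
  rw [h.conformalFactor_eq_of_isConformalNormal hn hu hξ]
  have hn' : (2 : ℝ) ≤ n := by exact_mod_cast hn
  exact mul_nonneg (div_nonneg (by linarith) (by linarith))
    (trace_inv_mul_sq_nonneg (h.posDef u hu) (h.conformalSecondForm_transpose hu ξ))

/-! ### The Codazzi equation and the vanishing of the conformal form -/

theorem diff_conformalN (h : IsSpacelikeLift U Y) (hu : u ∈ U) :
    DifferentiableAt ℝ (conformalN Y) u :=
  differentiableAt_of_contDiffOn h.isOpen hu h.smooth_conformalN

theorem diff_pd_conformalN (h : IsSpacelikeLift U Y) (hu : u ∈ U) (i : Fin n) :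
    DifferentiableAt ℝ (pd i (conformalN Y)) u :=
  differentiableAt_of_contDiffOn h.isOpen hu (contDiffOn_pd h.isOpen h.smooth_conformalN i)

theorem blaschkeTensor_transpose (h : IsSpacelikeLift U Y) (hu : u ∈ U) :
    (blaschkeTensor Y u)ᵀ = blaschkeTensor Y u :=
  h.conformalSecondForm_transpose hu _

/-- Differentiate $\langle N,\partial_jY\rangle=0$. -/
theorem blaschkeTensor_eq (h : IsSpacelikeLift U Y) (hu : u ∈ U) (i j : Fin n) :
    blaschkeTensor Y u i j = ip (pd i (conformalN Y) u) (pd j Y u) := by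
  have h1 := pd_ip (h.diff_conformalN hu) (h.diff_pd hu j) i
  rw [pd_congr_of_eqOn h.isOpen hu (fun w hw => h.ip_conformalN_pd hw j), pd_const,
    ip_comm (conformalN Y u)] at h1
  rw [blaschkeTensor, Matrix.of_apply]
  linarith

theorem ip_pd_conformalN_self (h : IsSpacelikeLift U Y) (hn : n ≠ 0) (hu : u ∈ U) (i : Fin n) :
    ip (pd i (conformalN Y) u) (Y u) = 0 := by
  have h1 := pd_ip (h.diff_conformalN hu) (h.diff hu) i
  rw [pd_congr_of_eqOn h.isOpen hu (fun w hw => h.ip_conformalN_self hn hw), pd_const,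
    h.ip_conformalN_pd hu] at h1
  linarith

theorem ip_pd_conformalN_conformalN (h : IsSpacelikeLift U Y) (hn : n ≠ 0) (hu : u ∈ U)
    (i : Fin n) : ip (pd i (conformalN Y) u) (conformalN Y u) = 0 := by
  have h1 := pd_ip (h.diff_conformalN hu) (h.diff_conformalN hu) i
  rw [pd_congr_of_eqOn h.isOpen hu (fun w hw => h.ip_conformalN_conformalN hn hw), pd_const,
    ip_comm (conformalN Y u)] at h1
  linarith

theorem christoffel_comm (h : IsSpacelikeLift U Y) (hu : u ∈ U) (k i j : Fin n) :
    christoffel (inducedMetric Y) k i j u = christoffel (inducedMetric Y) k j i u := by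
  rw [h.christoffel_eq hu, h.christoffel_eq hu, h.pd_pd_comm hu]

/-- The Codazzi equation for the Blaschke tensor. -/
theorem codazzi (h : IsSpacelikeLift U Y) (hn : n ≠ 0) (hu : u ∈ U) (hξ : IsConformalNormal Y u ξ)
    (i j k : Fin n) :
    covDeriv (inducedMetric Y) (blaschkeTensor Y) i j k u
        - covDeriv (inducedMetric Y) (blaschkeTensor Y) k j i u
      = conformalForm Y ξ u k * conformalSecondForm Y ξ u i j
        - conformalForm Y ξ u i * conformalSecondForm Y ξ u k j := by
  have hN := h.isNormalFrame hn hu hξ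
  have e1 : ∀ a b : Fin n, ip (pd a (conformalN Y) u) (pd b (pd j Y) u)
      = ∑ l, christoffel (inducedMetric Y) l b j u * blaschkeTensor Y u a l
        - conformalForm Y ξ u a * conformalSecondForm Y ξ u b j := by
    intro a b
    -- Pairing with the normal vector $Y_{,bj}$ isolates the normal part of $\partial_aN$, which
    -- lies along $\xi$ only; the Christoffel terms account for the tangential part.
    have e2 := hN.ip_eq h hu (v := pd a (conformalN Y) u) (h.ip_secondCov_pd hu b j)
    rw [h.ip_pd_conformalN_self hn hu, h.ip_pd_conformalN_conformalN hn hu,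
      ip_secondCov hξ.orth_tangent, secondCov, ip_sub_right, ip_sum_right] at e2
    simp only [ip_smul_right, ← h.blaschkeTensor_eq hu] at e2
    simp only [conformalForm, conformalSecondForm, Matrix.of_apply]
    linarith
  have e3 : ∀ a b : Fin n, pd b (fun w => blaschkeTensor Y w a j) u
      = ip (pd b (pd a (conformalN Y)) u) (pd j Y u)
        + ip (pd a (conformalN Y) u) (pd b (pd j Y) u) := by
    intro a b
    rw [pd_congr_of_eqOn h.isOpen hu (fun w hw => h.blaschkeTensor_eq hw a j),
      pd_ip (h.diff_pd_conformalN hu a) (h.diff_pd hu j)]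
  -- Antisymmetrizing in $i,k$ cancels the second derivatives of $N$ and, by symmetry of $\Gamma$,
  -- the correction of the first index.
  rw [covDeriv, covDeriv, e3, e3, e1, e1, pd_comm h.isOpen hu h.smooth_conformalN i k]
  simp only [h.christoffel_comm hu _ i k]
  ring

/-- The conformal form of a canonical lift with parallel Blaschke tensor vanishes. -/
theorem conformalForm_eq_zero (h : IsSpacelikeLift U Y) (hn : 2 ≤ n) (hu : u ∈ U)
    (hf : conformalFactor Y u ≠ 0)
    (hA : ∀ i j k, covDeriv (inducedMetric Y) (blaschkeTensor Y) i j k u = 0)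
    (hξ : IsConformalNormal Y u ξ) (k : Fin n) : conformalForm Y ξ u k = 0 := by
  set S := (inducedMetric Y u)⁻¹ with hSdef
  set B := conformalSecondForm Y ξ u with hBdef
  set C := conformalForm Y ξ u
  have hS : Sᵀ = S := inducedMetric_inv_transpose Y u
  have hB : Bᵀ = B := h.conformalSecondForm_transpose hu ξ
  have key : ∀ i j k, C k * B i j = C i * B k j := by
    intro i j k
    have h1 := h.codazzi (by omega) hu hξ i j k
    rw [hA, hA, sub_zero] at h1
    linarith
  -- Contraction of `key` with an arbitrary $T^{ij}$, used for $T=g^{-1}$ and for $T=g^{-1}Bg^{-1}$.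
  have contract : ∀ (T : Matrix (Fin n) (Fin n) ℝ) (k : Fin n),
      (T * Bᵀ).trace * C k = (B *ᵥ (Tᵀ *ᵥ C)) k := by
    intro T k
    have h1 : ∀ i j, T i j * B i j * C k = B k j * (Tᵀ j i * C i) := by
      intro i j
      rw [mul_assoc, mul_comm (B i j), key i j k, Matrix.transpose_apply]
      ring
    simp only [Matrix.trace, Matrix.diag_apply, Matrix.mul_apply, Matrix.transpose_apply B,
      Finset.sum_mul, h1, Matrix.mulVec, dotProduct, Finset.mul_sum]
    exact Finset.sum_comm
  have hBSC : B *ᵥ (S *ᵥ C) = 0 := by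
    funext m
    have h1 := contract S m
    have h2 : (S * B).trace = 0 := h.trace_secondFormOperator (by omega) hu hξ
    rw [hB, h2, zero_mul, hS] at h1
    exact h1.symm
  -- Now the left side is $|B|^2C_k$, while the right side contains $BSC=0$. A nonzero conformal
  -- factor means $|B|^2\ne0$.
  have h1 := contract (S * B * S) k
  have h2 : (S * B * S)ᵀ = S * (B * S) := by
    rw [Matrix.transpose_mul, Matrix.transpose_mul, hS, hB]
  rw [h2, ← Matrix.mulVec_mulVec, ← Matrix.mulVec_mulVec, hBSC, Matrix.mulVec_zero,
    Matrix.mulVec_zero, hB, Pi.zero_apply] at h1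
  refine (mul_eq_zero.1 h1).resolve_left fun h3 => hf ?_
  rw [h.conformalFactor_eq_of_isConformalNormal hn hu hξ, secondFormOperator, ← hSdef, ← hBdef,
    ← Matrix.mul_assoc, h3, mul_zero]

/-! ### Commutation of the Blaschke operator with the second form and the curvature -/

theorem smooth_blaschkeOperator (h : IsSpacelikeLift U Y) (i j : Fin n) :
    ContDiffOn ℝ ∞ (fun w => blaschkeOperator Y w i j) U :=
  contDiffOn_mul_apply h.smooth_inv
    (fun a b => (contDiffOn_ip (h.smooth_pd_pd a b) h.smooth_conformalN).neg) i j

theorem diff_blaschkeOperator (h : IsSpacelikeLift U Y) (hu : u ∈ U) (i j : Fin n) :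
    DifferentiableAt ℝ (fun w => blaschkeOperator Y w i j) u :=
  differentiableAt_of_contDiffOn h.isOpen hu (h.smooth_blaschkeOperator i j)

theorem metric_mul_blaschkeOperator (h : IsSpacelikeLift U Y) (hu : u ∈ U) :
    inducedMetric Y u * blaschkeOperator Y u = blaschkeTensor Y u := by
  rw [blaschkeOperator, ← Matrix.mul_assoc, h.mul_inv hu, Matrix.one_mul]

theorem metric_mul_secondFormOperator (h : IsSpacelikeLift U Y) (hu : u ∈ U) :
    inducedMetric Y u * secondFormOperator Y ξ u = conformalSecondForm Y ξ u := by
  rw [secondFormOperator, ← Matrix.mul_assoc, h.mul_inv hu, Matrix.one_mul]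

/-- The Blaschke operator and the conformal second fundamental form commute if the conformal form
vanishes. -/
theorem commute_of_conformalForm_eq_zero (h : IsSpacelikeLift U Y) (hn : n ≠ 0)
    (hC : ∀ w ∈ U, ∀ ν, IsConformalNormal Y w ν → ∀ i, conformalForm Y ν w i = 0) (hu : u ∈ U)
    (hξ : IsConformalNormal Y u ξ) :
    Commute (blaschkeOperator Y u) (secondFormOperator Y ξ u) := by
  -- With $C=0$ the derivative of $N$ is tangential. The formula is needed on all of `U` because it
  -- is differentiated next; the normal $\nu$ is chosen pointwise, with no regularity in $w$.
  have e1 : ∀ i, ∀ w ∈ U, pd i (conformalN Y) w = ∑ l, blaschkeOperator Y w l i • pd l Y w := by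
    intro i w hw
    obtain ⟨ν, hν⟩ := h.exists_isConformalNormal hn hw
    have hN := h.isNormalFrame hn hw hν
    have h0 : ip (pd i (conformalN Y) w) ν = 0 := neg_eq_zero.1 (hC w hw ν hν i)
    have h1 := hN.expand h hw (pd i (conformalN Y) w)
    rw [h.ip_pd_conformalN_self hn hw, h.ip_pd_conformalN_conformalN hn hw, h0] at h1
    simp only [zero_smul, add_zero, sub_zero, zero_add, ← h.blaschkeTensor_eq hw] at h1
    rw [h1]
    refine Finset.sum_congr rfl fun l _ => ?_
    rw [blaschkeOperator, Matrix.mul_apply]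
    congr 1
    exact Finset.sum_congr rfl fun j _ => by
      rw [← congrFun (congrFun (h.blaschkeTensor_transpose hw) i) j, Matrix.transpose_apply]
  have e2 : ∀ i k, ip (pd k (pd i (conformalN Y)) u) ξ
      = -(conformalSecondForm Y ξ u * blaschkeOperator Y u) k i := by
    intro i k
    rw [pd_congr_of_eqOn h.isOpen hu (e1 i), pd_sum (f := fun l w => blaschkeOperator Y w l i •
      pd l Y w) (fun l _ => (h.diff_blaschkeOperator hu l i).fun_smul (h.diff_pd hu l)),
      ip_sum_left, Matrix.mul_apply, ← Finset.sum_neg_distrib]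
    refine Finset.sum_congr rfl fun l _ => ?_
    rw [pd_smul (h.diff_blaschkeOperator hu l i) (h.diff_pd hu l), ip_add_left, ip_smul_left,
      ip_smul_left, ip_comm (pd l Y u), hξ.orth_tangent, conformalSecondForm, Matrix.of_apply]
    ring
  set S := (inducedMetric Y u)⁻¹ with hSdef
  set B := conformalSecondForm Y ξ u with hBdef
  set A := blaschkeTensor Y u with hAdef
  have hS : Sᵀ = S := inducedMetric_inv_transpose Y u
  have hB : Bᵀ = B := h.conformalSecondForm_transpose hu ξ
  have hA : Aᵀ = A := h.blaschkeTensor_transpose hu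
  -- The matrix $BSA$ is minus $\langle\partial_k\partial_iN,\xi\rangle$, hence symmetric.
  have e3 : B * (S * A) = A * S * B := by
    have e4 : (B * (S * A))ᵀ = B * (S * A) := by
      ext k i
      have h1 := e2 k i
      rw [pd_comm h.isOpen hu h.smooth_conformalN, e2] at h1
      exact (neg_injective h1).symm
    rw [← e4, Matrix.transpose_mul, Matrix.transpose_mul, hS, hB, hA]
  change S * A * (S * B) = S * B * (S * A)
  rw [Matrix.mul_assoc S B, e3]
  simp only [Matrix.mul_assoc]

/-- The derivative of a parallel Blaschke operator. -/
theorem pdMat_blaschkeOperator (h : IsSpacelikeLift U Y) (hu : u ∈ U)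
    (hA : ∀ i j k, covDeriv (inducedMetric Y) (blaschkeTensor Y) i j k u = 0) (k : Fin n) :
    pdMat k (blaschkeOperator Y) u = blaschkeOperator Y u * christoffelMat Y k u
      - christoffelMat Y k u * blaschkeOperator Y u := by
  have e1 : pdMat k (blaschkeTensor Y) u = (christoffelMat Y k u)ᵀ * blaschkeTensor Y u
      + blaschkeTensor Y u * christoffelMat Y k u := by
    ext i j
    have h1 := hA i j k
    rw [covDeriv, sub_sub, sub_eq_zero] at h1
    rw [pdMat_apply, h1, Matrix.add_apply, Matrix.mul_apply, Matrix.mul_apply]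
    congr 1
    exact Finset.sum_congr rfl fun l _ => mul_comm _ _
  have e2 : pdMat k (blaschkeTensor Y) u = (inducedMetric Y u * christoffelMat Y k u
      + (christoffelMat Y k u)ᵀ * inducedMetric Y u) * blaschkeOperator Y u
      + inducedMetric Y u * pdMat k (blaschkeOperator Y) u := by
    rw [← h.pdMat_metric hu, ← pdMat_mul (h.diff_metric hu) (h.diff_blaschkeOperator hu)]
    exact pdMat_congr_of_eqOn h.isOpen hu (fun w hw => (h.metric_mul_blaschkeOperator hw).symm) k
  have e3 : inducedMetric Y u * pdMat k (blaschkeOperator Y) u = inducedMetric Y u *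
      (blaschkeOperator Y u * christoffelMat Y k u
        - christoffelMat Y k u * blaschkeOperator Y u) := by
    rw [eq_sub_of_add_eq' e2.symm, e1, ← h.metric_mul_blaschkeOperator hu]
    noncomm_ring
  have e4 := congrArg ((inducedMetric Y u)⁻¹ * ·) e3
  simp only [← Matrix.mul_assoc (inducedMetric Y u)⁻¹, h.inv_mul hu, Matrix.one_mul] at e4
  exact e4

/-- A parallel Blaschke operator commutes with the curvature. -/
theorem commute_curvatureMat (h : IsSpacelikeLift U Y)
    (hA : ∀ w ∈ U, ∀ i j k, covDeriv (inducedMetric Y) (blaschkeTensor Y) i j k w = 0)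
    (hu : u ∈ U) (i j : Fin n) :
    blaschkeOperator Y u * curvatureMat Y i j u = curvatureMat Y i j u * blaschkeOperator Y u := by
  have e1 : ∀ k l : Fin n, pdMat l (pdMat k (blaschkeOperator Y)) u
      = (blaschkeOperator Y u * christoffelMat Y l u
          - christoffelMat Y l u * blaschkeOperator Y u) * christoffelMat Y k u
        + blaschkeOperator Y u * pdMat l (christoffelMat Y k) u
        - (pdMat l (christoffelMat Y k) u * blaschkeOperator Y u + christoffelMat Y k u *
          (blaschkeOperator Y u * christoffelMat Y l u
            - christoffelMat Y l u * blaschkeOperator Y u)) := by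
    intro k l
    have hd : ∀ {P Q : EuclideanSpace ℝ (Fin n) → Matrix (Fin n) (Fin n) ℝ},
        (∀ i j, DifferentiableAt ℝ (fun w => P w i j) u) →
        (∀ i j, DifferentiableAt ℝ (fun w => Q w i j) u) →
        ∀ i j, DifferentiableAt ℝ (fun w => (P w * Q w) i j) u := by
      intro P Q hP hQ i j
      simp only [Matrix.mul_apply]
      exact DifferentiableAt.fun_sum fun l _ => (hP i l).mul (hQ l j)
    rw [pdMat_congr_of_eqOn h.isOpen hu (fun w hw => h.pdMat_blaschkeOperator hw (hA w hw) k),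
      pdMat_sub (hd (h.diff_blaschkeOperator hu) (h.diff_christoffelMat hu k))
        (hd (h.diff_christoffelMat hu k) (h.diff_blaschkeOperator hu)),
      pdMat_mul (h.diff_blaschkeOperator hu) (h.diff_christoffelMat hu k),
      pdMat_mul (h.diff_christoffelMat hu k) (h.diff_blaschkeOperator hu),
      h.pdMat_blaschkeOperator hu (hA u hu)]
  -- Equality of the mixed derivatives obtained from $\partial_kA=[A,\Gamma_k]$ is
  -- $[A,\partial_i\Gamma_j-\partial_j\Gamma_i+[\Gamma_i,\Gamma_j]]=0$.
  have e2 := pdMat_comm h.isOpen hu h.smooth_blaschkeOperator i j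
  rw [e1, e1, ← sub_eq_zero] at e2
  rw [curvatureMat_eq, ← sub_eq_zero, ← e2]
  noncomm_ring

/-- The eigenvalue relation for a parallel Blaschke tensor. -/
theorem add_eq_mul_of_ne (h : IsSpacelikeLift U Y) (hn : n ≠ 0)
    (hA : ∀ w ∈ U, ∀ i j k, covDeriv (inducedMetric Y) (blaschkeTensor Y) i j k w = 0)
    (hu : u ∈ U) (hξ : IsConformalNormal Y u ξ) {x y : Fin n → ℝ} {a₁ a₂ b₁ b₂ : ℝ}
    (hx : x ⬝ᵥ (inducedMetric Y u *ᵥ x) = 1) (hy : y ⬝ᵥ (inducedMetric Y u *ᵥ y) = 1)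
    (hxy : x ⬝ᵥ (inducedMetric Y u *ᵥ y) = 0)
    (hax : blaschkeOperator Y u *ᵥ x = a₁ • x) (hay : blaschkeOperator Y u *ᵥ y = a₂ • y)
    (hbx : secondFormOperator Y ξ u *ᵥ x = b₁ • x) (hby : secondFormOperator Y ξ u *ᵥ y = b₂ • y)
    (hne : a₁ ≠ a₂) : a₁ + a₂ = b₁ * b₂ := by
  set G := inducedMetric Y u with hG
  have hN := h.isNormalFrame hn hu hξ
  have hGt : Gᵀ = G := inducedMetric_transpose Y u
  -- $A$ is self-adjoint and commutes with $R$, so it can be moved onto `x` or onto `y`, giving the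
  -- factor $a_1$ or $a_2$.
  have hzero : ∀ i j, x ⬝ᵥ ((G * curvatureMat Y i j u) *ᵥ y) = 0 := by
    intro i j
    set R := curvatureMat Y i j u with hR
    have e1 : x ⬝ᵥ ((G * (blaschkeOperator Y u * R)) *ᵥ y)
        = a₁ * (x ⬝ᵥ ((G * R) *ᵥ y)) := by
      have e2 : (G * blaschkeOperator Y u)ᵀ = G * blaschkeOperator Y u := by
        rw [hG, h.metric_mul_blaschkeOperator hu, h.blaschkeTensor_transpose hu]
      rw [← Matrix.mul_assoc, ← Matrix.mulVec_mulVec, Matrix.dotProduct_mulVec, ← e2,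
        Matrix.vecMul_transpose, ← Matrix.mulVec_mulVec, hax, Matrix.mulVec_smul, smul_dotProduct,
        smul_eq_mul, ← Matrix.mulVec_mulVec, Matrix.dotProduct_mulVec x, ← Matrix.vecMul_transpose,
        hGt]
    have e3 : x ⬝ᵥ ((G * (blaschkeOperator Y u * R)) *ᵥ y)
        = a₂ * (x ⬝ᵥ ((G * R) *ᵥ y)) := by
      rw [h.commute_curvatureMat hA hu, ← Matrix.mul_assoc, ← Matrix.mulVec_mulVec, hay,
        Matrix.mulVec_smul, dotProduct_smul, smul_eq_mul]
    have e4 : (a₁ - a₂) * (x ⬝ᵥ ((G * R) *ᵥ y)) = 0 := by rw [sub_mul, ← e1, ← e3, sub_self]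
    exact (mul_eq_zero.1 e4).resolve_left (sub_ne_zero.2 hne)
  have hform : ∀ {T X : Matrix (Fin n) (Fin n) ℝ} {z : Fin n → ℝ} {c : ℝ},
      G * T = X → T *ᵥ z = c • z → X *ᵥ z = c • (G *ᵥ z) := by
    intro T X z c hT hz
    rw [← hT, ← Matrix.mulVec_mulVec, hz, Matrix.mulVec_smul]
  have hAx := hform (h.metric_mul_blaschkeOperator hu) hax
  have hAy := hform (h.metric_mul_blaschkeOperator hu) hay
  have hBx := hform (h.metric_mul_secondFormOperator hu) hbx
  have hBy := hform (h.metric_mul_secondFormOperator hu) hby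
  set A := blaschkeTensor Y u with hAdef
  set B := conformalSecondForm Y ξ u with hBdef
  have hgauss : ∀ i j, x ⬝ᵥ ((G * curvatureMat Y i j u) *ᵥ y)
      = (a₁ + a₂ - b₁ * b₂) * ((G *ᵥ x) i * (G *ᵥ y) j - (G *ᵥ y) i * (G *ᵥ x) j) := by
    intro i j
    have e1 : ∀ m k, (G * curvatureMat Y i j u) m k
        = A j k * G i m + G j k * A i m - B j k * B i m
          - (A i k * G j m + G i k * A j m - B i k * B j m) := by
      intro m k
      rw [hG, h.gauss hu, hN.ip_secondCov_secondCov h hu, hN.ip_secondCov_secondCov h hu]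
      rfl
    have e2 : ∀ (X Z : Matrix (Fin n) (Fin n) ℝ) (p q : Fin n),
        ∑ m, x m * ∑ k, X p k * Z q m * y k = (X *ᵥ y) p * (Z *ᵥ x) q := by
      intro X Z p q
      simp only [Matrix.mulVec, dotProduct]
      rw [Finset.sum_mul_sum, Finset.sum_comm]
      simp only [Finset.mul_sum]
      exact Finset.sum_congr rfl fun m _ => Finset.sum_congr rfl fun k _ => by ring
    have e3 : x ⬝ᵥ ((G * curvatureMat Y i j u) *ᵥ y)
        = (A *ᵥ y) j * (G *ᵥ x) i + (G *ᵥ y) j * (A *ᵥ x) i - (B *ᵥ y) j * (B *ᵥ x) i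
          - ((A *ᵥ y) i * (G *ᵥ x) j + (G *ᵥ y) i * (A *ᵥ x) j
            - (B *ᵥ y) i * (B *ᵥ x) j) := by
      simp only [← e2, ← Finset.sum_add_distrib, ← Finset.sum_sub_distrib, ← mul_add, ← mul_sub,
        ← add_mul, ← sub_mul, ← e1]
      rfl
    rw [e3, hAx, hAy, hBx, hBy]
    simp only [Pi.smul_apply, smul_eq_mul]
    ring
  have hyx : y ⬝ᵥ (G *ᵥ x) = 0 := by
    rw [Matrix.dotProduct_mulVec, ← Matrix.mulVec_transpose, hGt, dotProduct_comm, hxy]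
  -- Evaluating the 2-form on $(x,y)$ gives the Gram determinant of an orthonormal pair, which
  -- extracts the scalar factor in `hgauss`.
  have hsum : ∑ i, ∑ j, x i * y j *
      ((G *ᵥ x) i * (G *ᵥ y) j - (G *ᵥ y) i * (G *ᵥ x) j) = 1 := by
    have e1 : ∑ i, ∑ j, x i * y j * ((G *ᵥ x) i * (G *ᵥ y) j - (G *ᵥ y) i * (G *ᵥ x) j)
        = (x ⬝ᵥ (G *ᵥ x)) * (y ⬝ᵥ (G *ᵥ y)) - (x ⬝ᵥ (G *ᵥ y)) * (y ⬝ᵥ (G *ᵥ x)) := by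
      simp only [dotProduct, Finset.sum_mul_sum, ← Finset.sum_sub_distrib]
      exact Finset.sum_congr rfl fun i _ => Finset.sum_congr rfl fun j _ => by ring
    rw [e1, hx, hy, hxy, hyx]
    ring
  have hfin : (a₁ + a₂ - b₁ * b₂) * 1 = 0 := by
    rw [← hsum, Finset.mul_sum]
    refine Finset.sum_eq_zero fun i _ => ?_
    rw [Finset.mul_sum]
    refine Finset.sum_eq_zero fun j _ => ?_
    have e1 := (hgauss i j).symm.trans (hzero i j)
    rw [mul_left_comm, e1, mul_zero]
  linarith

/-- The characteristic polynomial of a parallel Blaschke operator is locally constant. -/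
theorem charpoly_blaschkeOperator_eq (h : IsSpacelikeLift U Y)
    (hA : ∀ w ∈ U, ∀ i j k, covDeriv (inducedMetric Y) (blaschkeTensor Y) i j k w = 0)
    {V : Set (EuclideanSpace ℝ (Fin n))} (hVU : V ⊆ U) (hV : IsOpen V) (hVc : IsPreconnected V)
    {w : EuclideanSpace ℝ (Fin n)} (hu : u ∈ V) (hw : w ∈ V) :
    (blaschkeOperator Y u).charpoly = (blaschkeOperator Y w).charpoly := by
  refine Polynomial.funext fun t => ?_
  rw [Matrix.eval_charpoly, Matrix.eval_charpoly]
  have hM : ∀ i j, ContDiffOn ℝ ∞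
      (fun v => (Matrix.scalar (Fin n) t - blaschkeOperator Y v) i j) U := fun i j =>
    contDiffOn_const.sub (h.smooth_blaschkeOperator i j)
  have hdet : ContDiffOn ℝ ∞ (fun v => (Matrix.scalar (Fin n) t - blaschkeOperator Y v).det) U :=
    contDiffOn_det hM
  have hpd : ∀ v ∈ U, ∀ k,
      pd k (fun v => (Matrix.scalar (Fin n) t - blaschkeOperator Y v).det) v = 0 := by
    intro v hv k
    rw [pd_det fun i j => differentiableAt_of_contDiffOn h.isOpen hv (hM i j)]
    set M := Matrix.scalar (Fin n) t - blaschkeOperator Y v with hMdef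
    -- $M=t-A$ also satisfies $\partial_kM=[M,\Gamma_k]$. The trace of
    -- $\operatorname{adj}(M)[M,\Gamma_k]$ vanishes because
    -- $\operatorname{adj}(M)M=M\operatorname{adj}(M)$ is scalar.
    have e1 : pdMat k (fun v => Matrix.scalar (Fin n) t - blaschkeOperator Y v) v
        = M * christoffelMat Y k v - christoffelMat Y k v * M := by
      rw [pdMat_sub (A := fun _ => Matrix.scalar (Fin n) t) (fun _ _ => differentiableAt_const _) (h.diff_blaschkeOperator hv),
        h.pdMat_blaschkeOperator hv (hA v hv), hMdef]
      have e2 : pdMat k (fun _ => Matrix.scalar (Fin n) t) v = 0 := by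
        ext i j
        exact pd_const _ _
      rw [e2, sub_mul, mul_sub, (Matrix.scalar_commute t (fun r => Commute.all t r) _).eq]
      abel
    rw [e1, mul_sub, Matrix.trace_sub, ← Matrix.mul_assoc, Matrix.adjugate_mul,
      ← Matrix.mul_assoc, Matrix.trace_mul_comm _ M, ← Matrix.mul_assoc, Matrix.mul_adjugate,
      sub_self]
  refine hV.is_const_of_fderiv_eq_zero (𝕜 := ℝ) hVc
    ((hdet.mono hVU).differentiableOn (by simp)) (fun v hv => ?_) hu hw
  refine ContinuousLinearMap.coe_injective ?_
  refine (EuclideanSpace.basisFun (Fin n) ℝ).toBasis.ext fun k => ?_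
  have e1 := hpd v (hVU hv) k
  rw [pd] at e1
  simpa using e1

end IsSpacelikeLift

/-! ### Change of lift and of coordinates -/

section ChangeOfLift

variable {n : ℕ}

/-- The Jacobian matrix of a change of coordinates. -/
def jacobianMat (τ : EuclideanSpace ℝ (Fin n) → EuclideanSpace ℝ (Fin n))
    (w : EuclideanSpace ℝ (Fin n)) : Matrix (Fin n) (Fin n) ℝ :=
  Matrix.of fun a i => pd i τ w a

theorem pd_comp {F : Type*} [NormedAddCommGroup F] [NormedSpace ℝ F]
    {τ : EuclideanSpace ℝ (Fin n) → EuclideanSpace ℝ (Fin n)} {f : EuclideanSpace ℝ (Fin n) → F}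
    {w : EuclideanSpace ℝ (Fin n)} (hτ : DifferentiableAt ℝ τ w) (hf : DifferentiableAt ℝ f (τ w))
    (i : Fin n) : pd i (fun v => f (τ v)) w = ∑ a, jacobianMat τ w a i • pd a f (τ w) := by
  have h1 : pd i (fun v => f (τ v)) w = fderiv ℝ f (τ w) (pd i τ w) :=
    congrArg (fun L => L (EuclideanSpace.single i (1 : ℝ)))
      (hf.hasFDerivAt.comp w hτ.hasFDerivAt).fderiv
  have h2 : pd i τ w = ∑ a, jacobianMat τ w a i • EuclideanSpace.single a (1 : ℝ) := by
    have h3 := (EuclideanSpace.basisFun (Fin n) ℝ).sum_repr (pd i τ w)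
    simp only [EuclideanSpace.basisFun_apply, EuclideanSpace.basisFun_repr] at h3
    exact h3.symm
  rw [h1, h2, map_sum]
  exact Finset.sum_congr rfl fun a _ => by rw [map_smul]; rfl

theorem inv_mul_of_congruence {G B J : Matrix (Fin n) (Fin n) ℝ} {c d : ℝ} (hc : c ≠ 0)
    (hG : G.det ≠ 0) (hJ : J.det ≠ 0) :
    (c • (Jᵀ * G * J))⁻¹ * (d • (Jᵀ * B * J)) = (d / c) • (J⁻¹ * (G⁻¹ * B) * J) := by
  have hJt : IsUnit Jᵀ.det := by rw [Matrix.det_transpose]; exact hJ.isUnit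
  have e1 : (c • (Jᵀ * G * J))⁻¹ = c⁻¹ • (Jᵀ * G * J)⁻¹ := by
    refine Matrix.inv_smul' (Jᵀ * G * J) (Units.mk0 c hc) (IsUnit.mk0 _ ?_)
    rw [Matrix.det_mul, Matrix.det_mul, Matrix.det_transpose]
    exact mul_ne_zero (mul_ne_zero hJ hG) hJ
  rw [e1, Matrix.mul_inv_rev, Matrix.mul_inv_rev, smul_mul_smul_comm]
  have e2 : J⁻¹ * (G⁻¹ * Jᵀ⁻¹) * (Jᵀ * B * J) = J⁻¹ * (G⁻¹ * B) * J := by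
    simp only [Matrix.mul_assoc]
    rw [← Matrix.mul_assoc Jᵀ⁻¹, Matrix.nonsing_inv_mul _ hJt, Matrix.one_mul]
  rw [e2, div_eq_inv_mul]

variable {U W : Set (EuclideanSpace ℝ (Fin n))} {w : EuclideanSpace ℝ (Fin n)}
  {Y Z : EuclideanSpace ℝ (Fin n) → Fin (n + 1 + 2) → ℝ}

/-- `Z = μ · (Y ∘ τ)` on `W`, for space-like lifts `Y` on `U` and `Z` on `W`. -/
structure IsChangeOfLift (U W : Set (EuclideanSpace ℝ (Fin n)))
    (Y Z : EuclideanSpace ℝ (Fin n) → Fin (n + 1 + 2) → ℝ) (μ : EuclideanSpace ℝ (Fin n) → ℝ)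
    (τ : EuclideanSpace ℝ (Fin n) → EuclideanSpace ℝ (Fin n)) : Prop where
  left : IsSpacelikeLift U Y
  right : IsSpacelikeLift W Z
  smooth_factor : ContDiffOn ℝ ∞ μ W
  smooth_map : ContDiffOn ℝ ∞ τ W
  mapsTo : ∀ w ∈ W, τ w ∈ U
  eq : ∀ w ∈ W, Z w = μ w • Y (τ w)

namespace IsChangeOfLift

variable {μ : EuclideanSpace ℝ (Fin n) → ℝ}
  {τ : EuclideanSpace ℝ (Fin n) → EuclideanSpace ℝ (Fin n)}

theorem diff_factor (h : IsChangeOfLift U W Y Z μ τ) (hw : w ∈ W) : DifferentiableAt ℝ μ w :=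
  differentiableAt_of_contDiffOn h.right.isOpen hw h.smooth_factor

theorem diff_map (h : IsChangeOfLift U W Y Z μ τ) (hw : w ∈ W) : DifferentiableAt ℝ τ w :=
  differentiableAt_of_contDiffOn h.right.isOpen hw h.smooth_map

theorem diff_jacobianMat (h : IsChangeOfLift U W Y Z μ τ) (hw : w ∈ W) (a i : Fin n) :
    DifferentiableAt ℝ (fun v => jacobianMat τ v a i) w :=
  (EuclideanSpace.proj a : EuclideanSpace ℝ (Fin n) →L[ℝ] ℝ).differentiableAt.comp w
    (differentiableAt_of_contDiffOn h.right.isOpen hw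
      (contDiffOn_pd h.right.isOpen h.smooth_map i))

theorem pd_eq (h : IsChangeOfLift U W Y Z μ τ) (hw : w ∈ W) (j : Fin n) :
    pd j Z w = pd j μ w • Y (τ w) + μ w • ∑ a, jacobianMat τ w a j • pd a Y (τ w) := by
  have hY := h.left.diff (h.mapsTo w hw)
  have hYτ : DifferentiableAt ℝ (fun v => Y (τ v)) w := hY.comp w (h.diff_map hw)
  rw [pd_congr_of_eqOn h.right.isOpen hw h.eq, pd_smul (h.diff_factor hw) hYτ, pd_comp (h.diff_map hw) hY]

/-- The coefficients $\beta$ of the first derivatives stay anonymous: the formula is only paired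
with vectors orthogonal to $dY$. -/
theorem pd_pd_eq (h : IsChangeOfLift U W Y Z μ τ) (hw : w ∈ W) (i j : Fin n) :
    ∃ β : Fin n → ℝ, pd i (pd j Z) w = pd i (pd j μ) w • Y (τ w) + ∑ a, β a • pd a Y (τ w)
      + μ w • ∑ a, ∑ b, (jacobianMat τ w a j * jacobianMat τ w b i) • pd b (pd a Y) (τ w) := by
  have hwU := h.mapsTo w hw
  have hY := h.left.diff hwU
  have hτ := h.diff_map hw
  have hYτ : DifferentiableAt ℝ (fun v => Y (τ v)) w := hY.comp w hτ
  have hμ' : DifferentiableAt ℝ (pd j μ) w := differentiableAt_of_contDiffOn h.right.isOpen hw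
    (contDiffOn_pd h.right.isOpen h.smooth_factor j)
  have hYa : ∀ a, DifferentiableAt ℝ (fun v => pd a Y (τ v)) w := fun a =>
    (h.left.diff_pd hwU a).comp w hτ
  have hJ := h.diff_jacobianMat hw
  have hsum : DifferentiableAt ℝ (fun v => ∑ a, jacobianMat τ v a j • pd a Y (τ v)) w :=
    DifferentiableAt.fun_sum fun a _ => (hJ a j).fun_smul (hYa a)
  refine ⟨fun a => pd j μ w * jacobianMat τ w a i + pd i μ w * jacobianMat τ w a j
    + μ w * pd i (fun v => jacobianMat τ v a j) w, ?_⟩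
  rw [pd_congr_of_eqOn h.right.isOpen hw (fun v hv => h.pd_eq hv j),
    pd_add (hμ'.fun_smul hYτ) ((h.diff_factor hw).fun_smul hsum),
    pd_smul hμ' hYτ, pd_smul (h.diff_factor hw) hsum, pd_comp hτ hY,
    pd_sum (f := fun a v => jacobianMat τ v a j • pd a Y (τ v))
      (fun a _ => (hJ a j).fun_smul (hYa a))]
  have e1 : ∀ a, pd i (fun v => jacobianMat τ v a j • pd a Y (τ v)) w
      = pd i (fun v => jacobianMat τ v a j) w • pd a Y (τ w)
        + ∑ b, (jacobianMat τ w a j * jacobianMat τ w b i) • pd b (pd a Y) (τ w) := by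
    intro a
    rw [pd_smul (hJ a j) (hYa a), pd_comp hτ (h.left.diff_pd hwU a), Finset.smul_sum]
    simp only [smul_smul]
  simp only [e1, add_smul, mul_smul, Finset.sum_add_distrib, smul_add, Finset.smul_sum]
  abel

theorem inducedMetric_eq (h : IsChangeOfLift U W Y Z μ τ) (hw : w ∈ W) :
    inducedMetric Z w
      = (μ w ^ 2) • ((jacobianMat τ w)ᵀ * inducedMetric Y (τ w) * jacobianMat τ w) := by
  have hwU := h.mapsTo w hw
  have e5 : ∀ k, ip (pd k Y (τ w)) (Y (τ w)) = 0 := fun k =>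
    (ip_comm _ _).trans (h.left.ip_self_pd hwU k)
  ext i j
  rw [inducedMetric_apply, h.pd_eq hw, h.pd_eq hw]
  simp only [ip_add_left, ip_add_right, ip_smul_left, ip_smul_right, ip_sum_left, ip_sum_right,
    h.left.null _ hwU, h.left.ip_self_pd hwU, e5, mul_zero, Finset.sum_const_zero, add_zero,
    zero_add, Matrix.smul_apply, Matrix.mul_apply, Matrix.transpose_apply, smul_eq_mul,
    Finset.mul_sum, Finset.sum_mul, inducedMetric_apply]
  exact Finset.sum_congr rfl fun a _ => Finset.sum_congr rfl fun b _ => by ring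

theorem factor_ne_zero (h : IsChangeOfLift U W Y Z μ τ) (hn : n ≠ 0) (hw : w ∈ W) : μ w ≠ 0 := by
  intro h0
  have h1 := h.right.det_ne_zero hw
  have : Nonempty (Fin n) := ⟨⟨0, Nat.pos_of_ne_zero hn⟩⟩
  rw [h.inducedMetric_eq hw, h0] at h1
  simp at h1

theorem det_jacobianMat_ne_zero (h : IsChangeOfLift U W Y Z μ τ) (hw : w ∈ W) :
    (jacobianMat τ w).det ≠ 0 := by
  intro h0
  have h1 := h.right.det_ne_zero hw
  rw [h.inducedMetric_eq hw, Matrix.det_smul, Matrix.det_mul, h0, mul_zero, mul_zero] at h1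
  exact h1 rfl

/-- The Hessian of $\mu$ enters only through $\langle Y,\nu\rangle$. It drops out in two cases:
$\nu\perp Y$, for the conformal factor, or $\mu$ constant, where $\nu=N$ is allowed. -/
theorem conformalSecondForm_apply (h : IsChangeOfLift U W Y Z μ τ) (hw : w ∈ W)
    {ν : Fin (n + 1 + 2) → ℝ} (hν : ∀ a, ip ν (pd a Y (τ w)) = 0) (i j : Fin n) :
    conformalSecondForm Z ν w i j = -(pd i (pd j μ) w * ip (Y (τ w)) ν)
      + (μ w • ((jacobianMat τ w)ᵀ * conformalSecondForm Y ν (τ w) * jacobianMat τ w)) i j := by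
  obtain ⟨β, hβ⟩ := h.pd_pd_eq hw i j
  have e1 : ∀ a, ip (pd a Y (τ w)) ν = 0 := fun a => (ip_comm _ _).trans (hν a)
  rw [conformalSecondForm, Matrix.of_apply, hβ]
  simp only [ip_add_left, ip_smul_left, ip_sum_left, e1, mul_zero, Finset.sum_const_zero,
    Matrix.smul_apply, Matrix.mul_apply, Matrix.transpose_apply, smul_eq_mul, Finset.sum_mul,
    conformalSecondForm, Matrix.of_apply]
  rw [neg_add, neg_add, neg_zero, add_zero]
  congr 1
  rw [← mul_neg, ← Finset.sum_neg_distrib]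
  congr 1
  refine Finset.sum_congr rfl fun a _ => ?_
  rw [← Finset.sum_neg_distrib]
  exact Finset.sum_congr rfl fun b _ => by ring

theorem ip_pd_right (h : IsChangeOfLift U W Y Z μ τ) (hw : w ∈ W)
    {ν : Fin (n + 1 + 2) → ℝ} (hν0 : (∀ k, pd k μ w = 0) ∨ ip ν (Y (τ w)) = 0)
    (hν : ∀ a, ip ν (pd a Y (τ w)) = 0) (k : Fin n) : ip ν (pd k Z w) = 0 := by
  rw [h.pd_eq hw, ip_add_right, ip_smul_right, ip_smul_right, ip_sum_right,
    Finset.sum_eq_zero (fun a _ => by rw [ip_smul_right, hν, mul_zero]), mul_zero, add_zero]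
  rcases hν0 with h0 | h0
  · rw [h0 k, zero_mul]
  · rw [h0, mul_zero]

/-- The conformal factor of a lift has weight `-2`. -/
theorem conformalFactor_eq (h : IsChangeOfLift U W Y Z μ τ) (hn : 2 ≤ n) (hw : w ∈ W) :
    conformalFactor Z w = (μ w ^ 2)⁻¹ * conformalFactor Y (τ w) := by
  have hwU := h.mapsTo w hw
  -- The same $\xi$ serves both lifts: it need not be orthogonal to the new $N$, since the
  -- trace-free formula for the factor accepts any unit normal.
  obtain ⟨ξ, hξ⟩ := h.left.exists_isConformalNormal (by omega) hwU
  have hμ := h.factor_ne_zero (by omega) hw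
  have hJ := h.det_jacobianMat_ne_zero hw
  have hB : conformalSecondForm Z ξ w
      = μ w • ((jacobianMat τ w)ᵀ * conformalSecondForm Y ξ (τ w) * jacobianMat τ w) := by
    ext i j
    rw [h.conformalSecondForm_apply hw hξ.orth_tangent, ip_comm, hξ.orth_lift]
    ring
  have hop : (inducedMetric Z w)⁻¹ * conformalSecondForm Z ξ w = (μ w)⁻¹ •
      ((jacobianMat τ w)⁻¹ * ((inducedMetric Y (τ w))⁻¹ * conformalSecondForm Y ξ (τ w))
        * jacobianMat τ w) := by
    rw [hB, h.inducedMetric_eq hw, inv_mul_of_congruence (pow_ne_zero 2 hμ)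
      (h.left.det_ne_zero hwU) hJ]
    congr 1
    field_simp
  have hconj : ∀ X : Matrix (Fin n) (Fin n) ℝ,
      ((jacobianMat τ w)⁻¹ * X * jacobianMat τ w).trace = X.trace := by
    intro X
    rw [Matrix.trace_mul_comm, ← Matrix.mul_assoc, Matrix.mul_nonsing_inv _ hJ.isUnit,
      Matrix.one_mul]
  have hconj2 : ∀ X : Matrix (Fin n) (Fin n) ℝ,
      (jacobianMat τ w)⁻¹ * X * jacobianMat τ w * ((jacobianMat τ w)⁻¹ * X * jacobianMat τ w)
        = (jacobianMat τ w)⁻¹ * (X * X) * jacobianMat τ w := by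
    intro X
    simp only [Matrix.mul_assoc]
    rw [← Matrix.mul_assoc (jacobianMat τ w) (jacobianMat τ w)⁻¹,
      Matrix.mul_nonsing_inv _ hJ.isUnit, Matrix.one_mul]
  rw [h.right.conformalFactor_eq hn hw hξ.unit
      (by rw [h.eq w hw, ip_smul_right, hξ.orth_lift, mul_zero])
      (h.ip_pd_right hw (Or.inr hξ.orth_lift) hξ.orth_tangent),
    h.left.conformalFactor_eq hn hwU hξ.unit hξ.orth_lift hξ.orth_tangent, hop,
    smul_mul_smul_comm, Matrix.trace_smul, Matrix.trace_smul, hconj2, hconj, hconj, smul_eq_mul,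
    smul_eq_mul]
  field_simp

/-- For a change of lift with constant factor `±1`, the Blaschke operators are conjugate. -/
theorem charpoly_blaschkeOperator_eq {ε : ℝ} (h : IsChangeOfLift U W Y Z (fun _ => ε) τ)
    (hε : ε ^ 2 = 1) (hn : n ≠ 0) (hw : w ∈ W) :
    (blaschkeOperator Z w).charpoly = (blaschkeOperator Y (τ w)).charpoly := by
  have hwU := h.mapsTo w hw
  have hJ := h.det_jacobianMat_ne_zero hw
  have hd : ∀ i, pd i (fun _ : EuclideanSpace ℝ (Fin n) => ε) = fun _ => 0 := fun i =>
    funext fun v => pd_const ε i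
  have hB : ∀ ν : Fin (n + 1 + 2) → ℝ, (∀ a, ip ν (pd a Y (τ w)) = 0) → conformalSecondForm Z ν w
      = ε • ((jacobianMat τ w)ᵀ * conformalSecondForm Y ν (τ w) * jacobianMat τ w) := by
    intro ν hν
    ext i j
    rw [h.conformalSecondForm_apply hw hν, hd, pd_const]
    ring
  have hop : ∀ ν : Fin (n + 1 + 2) → ℝ, (∀ a, ip ν (pd a Y (τ w)) = 0) →
      (inducedMetric Z w)⁻¹ * conformalSecondForm Z ν w = ε • ((jacobianMat τ w)⁻¹
        * ((inducedMetric Y (τ w))⁻¹ * conformalSecondForm Y ν (τ w)) * jacobianMat τ w) := by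
    intro ν hν
    rw [hB ν hν, h.inducedMetric_eq hw, inv_mul_of_congruence (by rw [hε]; exact one_ne_zero)
      (h.left.det_ne_zero hwU) hJ,
      hε, div_one]
  have hconj : ∀ X : Matrix (Fin n) (Fin n) ℝ,
      ((jacobianMat τ w)⁻¹ * X * jacobianMat τ w).trace = X.trace := by
    intro X
    rw [Matrix.trace_mul_comm, ← Matrix.mul_assoc, Matrix.mul_nonsing_inv _ hJ.isUnit,
      Matrix.one_mul]
  have hpd0 : ∀ k, pd k (fun _ : EuclideanSpace ℝ (Fin n) => ε) w = 0 := fun k => pd_const ε k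
  have hε0 : ε ≠ 0 := fun h0 => by rw [h0] at hε; norm_num at hε
  have hlap_pd : ∀ a, ip (lap Z w) (pd a Y (τ w)) = 0 := by
    have h1 : (fun a => ip (lap Z w) (pd a Y (τ w))) ᵥ* jacobianMat τ w = 0 := by
      funext i
      have h2 := h.right.ip_lap_pd hw i
      rw [h.pd_eq hw, ip_add_right, ip_smul_right, ip_smul_right, ip_sum_right, pd_const, zero_mul,
        zero_add] at h2
      have h3 := (mul_eq_zero.1 h2).resolve_left hε0
      simp only [ip_smul_right] at h3
      rw [Pi.zero_apply, ← h3]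
      simp only [Matrix.vecMul, dotProduct, mul_comm]
    exact congrFun (Matrix.eq_zero_of_vecMul_eq_zero hJ h1)
  have hlapν : ∀ ν : Fin (n + 1 + 2) → ℝ, (∀ a, ip ν (pd a Y (τ w)) = 0) →
      ip (lap Z w - ε • lap Y (τ w)) ν = 0 := by
    intro ν hν
    rw [ip_sub_left, ip_smul_left, h.left.ip_lap hwU hν,
      h.right.ip_lap hw (h.ip_pd_right hw (Or.inl hpd0) hν), hop ν hν, Matrix.trace_smul, hconj,
      smul_eq_mul]
    ring
  -- Comparing inner products with a full frame replaces the transformation law of the Christoffel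
  -- symbols.
  have hlap : lap Z w = ε • lap Y (τ w) := by
    obtain ⟨ξ, hξ⟩ := h.left.exists_isConformalNormal hn hwU
    have hN := h.left.isNormalFrame hn hwU hξ
    rw [← sub_eq_zero, hN.expand h.left hwU (lap Z w - ε • lap Y (τ w)), hlapν _ hN.orth_pd,
      hlapν _ hN.normal_pd, hlapν _ (h.left.ip_self_pd hwU)]
    simp only [ip_sub_left, ip_smul_left, hlap_pd, h.left.ip_lap_pd hwU]
    simp
  have hN : conformalN Z w = ε • conformalN Y (τ w) := by
    rw [conformalN, conformalN, hlap, h.eq w hw, ip_smul_left, ip_smul_right, ← mul_assoc ε ε,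
      ← sq, hε, one_mul, smul_sub, smul_comm ε, smul_comm ε]
  have hA : blaschkeTensor Z w = ε • conformalSecondForm Z (conformalN Y (τ w)) w := by
    ext i j
    rw [blaschkeTensor, Matrix.of_apply, hN, ip_smul_right, Matrix.smul_apply,
      conformalSecondForm, Matrix.of_apply, smul_eq_mul, mul_neg]
  -- One sign comes from $N$ and one from the second derivatives of $Z$; they cancel since
  -- $\varepsilon^2=1$.
  have hT : blaschkeOperator Z w
      = (jacobianMat τ w)⁻¹ * blaschkeOperator Y (τ w) * jacobianMat τ w := by
    rw [blaschkeOperator, hA, Matrix.mul_smul, hop _ (h.left.ip_conformalN_pd hwU), smul_smul, ← sq,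
      hε, one_smul]
    rfl
  rw [hT, Matrix.charpoly_mul_comm, ← Matrix.mul_assoc, Matrix.mul_nonsing_inv _ hJ.isUnit,
    Matrix.one_mul]

end IsChangeOfLift

end ChangeOfLift

/-! ### Local lifts of hypersurfaces -/

section Hypersurfaces

variable {n : ℕ} {M : Type*} [TopologicalSpace M] [ChartedSpace (EuclideanSpace ℝ (Fin n)) M]
  {x : M → conformalSpace (n + 1) 1}
  {φ ψ : OpenPartialHomeomorph M (EuclideanSpace ℝ (Fin n))}
  {Y Z : EuclideanSpace ℝ (Fin n) → Fin (n + 1 + 2) → ℝ}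

theorem IsSpacelikeLift.mono {U V : Set (EuclideanSpace ℝ (Fin n))} (h : IsSpacelikeLift U Y)
    (hV : IsOpen V) (hVU : V ⊆ U) : IsSpacelikeLift V Y :=
  ⟨hV, h.smooth.mono hVU, fun u hu => h.null u (hVU hu), fun u hu => h.posDef u (hVU hu)⟩

theorem IsLocalLift.isSpacelikeLift (hY : IsLocalLift x φ Y) (hx : IsRegularSpacelike x) :
    IsSpacelikeLift φ.target Y := by
  refine ⟨φ.open_target, hY.smooth, fun u hu => ?_, hx.spacelike φ Y hY⟩
  obtain ⟨h0, h1⟩ := hY.lifts u hu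
  refine (x (φ.symm u)).2 (Y u) ?_
  rw [← h1, Projectivization.submodule_mk]
  exact Submodule.mem_span_singleton_self _

theorem IsCanonicalLift.conformalFactor_eq_one (hY : IsCanonicalLift x φ Y)
    (hx : IsRegularSpacelike x) (hn : n ≠ 0) {u : EuclideanSpace ℝ (Fin n)} (hu : u ∈ φ.target) :
    conformalFactor Y u = 1 := by
  have h := hY.isLocalLift.isSpacelikeLift hx
  have h1 : (1 - conformalFactor Y u) • inducedMetric Y u = 0 := by
    rw [sub_smul, one_smul, ← conformalMetric_eq, hY.canonical u hu, sub_self]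
  rcases smul_eq_zero.1 h1 with h2 | h2
  · linarith
  · have : Nonempty (Fin n) := ⟨⟨0, Nat.pos_of_ne_zero hn⟩⟩
    exact absurd (by rw [h2, Matrix.det_zero]) (h.det_ne_zero hu)

/-- Regular space-like hypersurfaces have canonical lifts near every point. -/
theorem IsRegularSpacelike.exists_isCanonicalLift (hx : IsRegularSpacelike x) (hn : 2 ≤ n) (p : M) :
    ∃ φ Y, IsCanonicalLift x φ Y ∧ p ∈ φ.source := by
  obtain ⟨φ, Y, hY, hp⟩ := hx.exists_lift p
  have h := hY.isSpacelikeLift hx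
  have : Nonempty (Fin n) := ⟨⟨0, by omega⟩⟩
  -- Nonnegativity and regularity give positivity. Rescaling by the square root then makes the
  -- factor $1$, because its weight is $-2$.
  have hpos : ∀ u ∈ φ.target, 0 < conformalFactor Y u := by
    intro u hu
    refine lt_of_le_of_ne (h.conformalFactor_nonneg hn hu) fun h0 => hx.regular φ Y hY u hu ?_
    rw [conformalMetric_eq, ← h0, zero_smul, Matrix.det_zero]
  have hsqrt : ContDiffOn ℝ ∞ (fun u => Real.sqrt (conformalFactor Y u)) φ.target :=
    h.smooth_conformalFactor.sqrt fun u hu => (hpos u hu).ne'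
  have hZ : IsLocalLift x φ (fun u => Real.sqrt (conformalFactor Y u) • Y u) := by
    refine ⟨hY.chart, hsqrt.fun_smul h.smooth, fun u hu => ?_⟩
    obtain ⟨h0, h1⟩ := hY.lifts u hu
    have hs := (Real.sqrt_pos.2 (hpos u hu)).ne'
    refine ⟨smul_ne_zero hs h0, ?_⟩
    rw [← h1, Projectivization.mk_eq_mk_iff']
    exact ⟨_, rfl⟩
  have hch : IsChangeOfLift φ.target φ.target Y
      (fun u => Real.sqrt (conformalFactor Y u) • Y u)
      (fun u => Real.sqrt (conformalFactor Y u)) id :=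
    ⟨h, hZ.isSpacelikeLift hx, hsqrt, contDiffOn_id, fun _ hu => hu, fun _ _ => rfl⟩
  refine ⟨φ, _, ⟨hZ, fun u hu => ?_⟩, hp⟩
  rw [conformalMetric_eq, hch.conformalFactor_eq hn hu, id, Real.sq_sqrt (hpos u hu).le,
    inv_mul_cancel₀ (hpos u hu).ne', one_smul]

/-- Two local lifts are related by a change of lift on the overlap of their domains. -/
theorem IsLocalLift.exists_isChangeOfLift [IsManifold (𝓡 n) ∞ M] (hY : IsLocalLift x φ Y)
    (hZ : IsLocalLift x ψ Z) (hx : IsRegularSpacelike x) :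
    ∃ μ, IsChangeOfLift φ.target (ψ.target ∩ ψ.symm ⁻¹' φ.source) Y Z μ
      (fun w => φ (ψ.symm w)) := by
  have hopen : IsOpen (ψ.target ∩ ψ.symm ⁻¹' φ.source) :=
    ψ.symm.isOpen_inter_preimage φ.open_source
  have hmaps : ∀ w ∈ ψ.target ∩ ψ.symm ⁻¹' φ.source, φ (ψ.symm w) ∈ φ.target :=
    fun w hw => φ.map_source hw.2
  have hτ : ContDiffOn ℝ ∞ (fun w => φ (ψ.symm w)) (ψ.target ∩ ψ.symm ⁻¹' φ.source) :=
    (contMDiffOn_of_mem_contDiffGroupoid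
      (IsManifold.compatible_of_mem_maximalAtlas hZ.chart hY.chart)).contDiffOn
  have h := hY.isSpacelikeLift hx
  have hYτ : ContDiffOn ℝ ∞ (fun w => Y (φ (ψ.symm w))) (ψ.target ∩ ψ.symm ⁻¹' φ.source) :=
    hY.smooth.comp hτ hmaps
  have hZs := hZ.smooth.mono (Set.inter_subset_left (t := ψ.symm ⁻¹' φ.source))
  have hne : ∀ w ∈ ψ.target ∩ ψ.symm ⁻¹' φ.source,
      Y (φ (ψ.symm w)) ⬝ᵥ Y (φ (ψ.symm w)) ≠ 0 := fun w hw =>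
    dotProduct_self_eq_zero.not.2 (hY.lifts _ (hmaps w hw)).1
  have hdot : ∀ {f g : EuclideanSpace ℝ (Fin n) → Fin (n + 1 + 2) → ℝ}
      {S : Set (EuclideanSpace ℝ (Fin n))}, ContDiffOn ℝ ∞ f S → ContDiffOn ℝ ∞ g S →
      ContDiffOn ℝ ∞ (fun w => f w ⬝ᵥ g w) S := by
    intro f g S hf hg
    rw [contDiffOn_pi] at hf hg
    simp only [dotProduct]
    exact ContDiffOn.sum fun i _ => (hf i).mul (hg i)
  -- Proportionality in projective space only gives a scalar at each point; this Euclidean quotient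
  -- is the same scalar and is visibly smooth.
  refine ⟨fun w => (Z w ⬝ᵥ Y (φ (ψ.symm w))) / (Y (φ (ψ.symm w)) ⬝ᵥ Y (φ (ψ.symm w))), h,
    (hZ.isSpacelikeLift hx).mono hopen Set.inter_subset_left,
    (hdot hZs hYτ).div (hdot hYτ hYτ) hne, hτ, hmaps, fun w hw => ?_⟩
  obtain ⟨h0, h1⟩ := hY.lifts _ (hmaps w hw)
  obtain ⟨h2, h3⟩ := hZ.lifts w hw.1
  rw [φ.left_inv hw.2, ← h3, eq_comm, Projectivization.mk_eq_mk_iff'] at h1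
  obtain ⟨c, hc⟩ := h1
  rw [← hc, smul_dotProduct, smul_eq_mul, mul_div_assoc, div_self (hne w hw), mul_one]

/-- The characteristic polynomial of the Blaschke operator does not depend on the canonical
lift. -/
theorem IsCanonicalLift.charpoly_eq [IsManifold (𝓡 n) ∞ M] (hY : IsCanonicalLift x φ Y)
    (hZ : IsCanonicalLift x ψ Z) (hx : IsRegularSpacelike x) (hn : 2 ≤ n) {p : M}
    (hpφ : p ∈ φ.source) (hpψ : p ∈ ψ.source) :
    (blaschkeOperator Z (ψ p)).charpoly = (blaschkeOperator Y (φ p)).charpoly := by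
  obtain ⟨μ, h⟩ := hY.isLocalLift.exists_isChangeOfLift hZ.isLocalLift hx
  set W := ψ.target ∩ ψ.symm ⁻¹' φ.source
  have hpW : ψ p ∈ W := ⟨ψ.map_source hpψ, by
    rw [Set.mem_preimage, ψ.left_inv hpψ]; exact hpφ⟩
  have hμ : ∀ w ∈ W, μ w ^ 2 = 1 := by
    intro w hw
    have h1 := h.conformalFactor_eq hn hw
    rw [hZ.conformalFactor_eq_one hx (by omega) hw.1,
      hY.conformalFactor_eq_one hx (by omega) (h.mapsTo w hw), mul_one] at h1
    rw [← inv_inv (μ w ^ 2), ← h1, inv_one]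
  have hμ0 : ∀ w ∈ W, μ w ≠ 0 := fun w hw => h.factor_ne_zero (by omega) hw
  -- Both conformal factors are $1$, so $\mu=\pm1$. On the open set where $\mu$ keeps its sign at `ψ
  -- p` it is constant, as the conjugation argument requires.
  let V := W ∩ (fun w => μ w * μ (ψ p)) ⁻¹' Set.Ioi 0
  have hV : IsOpen V :=
    (h.smooth_factor.continuousOn.mul continuousOn_const).isOpen_inter_preimage h.right.isOpen
      isOpen_Ioi
  have hVW : V ⊆ W := Set.inter_subset_left
  have hconst : ∀ w ∈ V, μ w = μ (ψ p) := by
    intro w hw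
    have h1 := hμ w hw.1
    have h2 := hμ _ hpW
    have h3 : 0 < μ w * μ (ψ p) := hw.2
    rcases sq_eq_sq_iff_eq_or_eq_neg.1 (h1.trans h2.symm) with h4 | h4
    · exact h4
    · rw [h4] at h3
      nlinarith
  have h' : IsChangeOfLift φ.target V Y Z (fun _ => μ (ψ p)) (fun w => φ (ψ.symm w)) :=
    ⟨h.left, h.right.mono hV hVW, contDiffOn_const, h.smooth_map.mono hVW,
      fun w hw => h.mapsTo w hw.1, fun w hw => by rw [h.eq w hw.1, hconst w hw]⟩
  have hpV : ψ p ∈ V := ⟨hpW, mul_self_pos.2 (hμ0 _ hpW)⟩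
  rw [h'.charpoly_blaschkeOperator_eq (hμ _ hpW) (by omega) hpV, ψ.left_inv hpψ]

theorem IsCanonicalLift.conformalForm_eq_zero (hY : IsCanonicalLift x φ Y)
    (hx : IsRegularSpacelike x) (hA : HasParallelBlaschkeTensor x) (hn : 2 ≤ n)
    {u : EuclideanSpace ℝ (Fin n)} (hu : u ∈ φ.target) {ξ : Fin (n + 1 + 2) → ℝ}
    (hξ : IsConformalNormal Y u ξ) (i : Fin n) : conformalForm Y ξ u i = 0 :=
  (hY.isLocalLift.isSpacelikeLift hx).conformalForm_eq_zero hn hu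
    (by rw [hY.conformalFactor_eq_one hx (by omega) hu]; exact one_ne_zero) (hA φ Y hY u hu) hξ i

theorem IsCanonicalLift.commute (hY : IsCanonicalLift x φ Y)
    (hx : IsRegularSpacelike x) (hA : HasParallelBlaschkeTensor x) (hn : 2 ≤ n)
    {u : EuclideanSpace ℝ (Fin n)} (hu : u ∈ φ.target) {ξ : Fin (n + 1 + 2) → ℝ}
    (hξ : IsConformalNormal Y u ξ) : Commute (blaschkeOperator Y u) (secondFormOperator Y ξ u) :=
  (hY.isLocalLift.isSpacelikeLift hx).commute_of_conformalForm_eq_zero (by omega)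
    (fun _ hw _ hν i => hY.conformalForm_eq_zero hx hA hn hw hν i) hu hξ

/-- The common eigenbasis of the Blaschke tensor and the conformal second fundamental form. -/
theorem IsCanonicalLift.exists_eigenbasis (hY : IsCanonicalLift x φ Y)
    (hx : IsRegularSpacelike x) (hA : HasParallelBlaschkeTensor x) (hn : 2 ≤ n)
    {u : EuclideanSpace ℝ (Fin n)} (hu : u ∈ φ.target) {ξ : Fin (n + 1 + 2) → ℝ}
    (hξ : IsConformalNormal Y u ξ) :
    ∃ (e : Fin n → Fin n → ℝ) (a b : Fin n → ℝ),
      (∀ i j, e i ⬝ᵥ (inducedMetric Y u *ᵥ e j) = if i = j then 1 else 0) ∧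
      (∀ i, blaschkeOperator Y u *ᵥ e i = a i • e i) ∧
      (∀ i, secondFormOperator Y ξ u *ᵥ e i = b i • e i) ∧
      ∀ i j, a i ≠ a j → a i + a j = b i * b j := by
  have h := hY.isLocalLift.isSpacelikeLift hx
  obtain ⟨e, a, b, he, ha, hb⟩ := exists_common_eigenbasis (h.posDef u hu)
    (h.blaschkeTensor_transpose hu) (h.conformalSecondForm_transpose hu ξ)
    (hY.commute hx hA hn hu hξ)
  refine ⟨e, a, b, he, ha, hb, fun i j hij => ?_⟩
  have hne : i ≠ j := fun h0 => hij (congrArg a h0)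
  exact h.add_eq_mul_of_ne (by omega) (hA φ Y hY) hu hξ (by rw [he, if_pos rfl])
    (by rw [he, if_pos rfl]) (by rw [he, if_neg hne]) (ha i) (ha j) (hb i) (hb j) hij

/-- At every point the Blaschke eigenvalues are real, with at most three different values. -/
theorem IsCanonicalLift.exists_charpoly_eq (hY : IsCanonicalLift x φ Y)
    (hx : IsRegularSpacelike x) (hA : HasParallelBlaschkeTensor x) (hn : 2 ≤ n)
    {u : EuclideanSpace ℝ (Fin n)} (hu : u ∈ φ.target) :
    ∃ a : Fin n → ℝ, (Set.range a).encard ≤ 3 ∧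
      (blaschkeOperator Y u).charpoly = ∏ i, (Polynomial.X - Polynomial.C (a i)) := by
  obtain ⟨ξ, hξ⟩ :=
    (hY.isLocalLift.isSpacelikeLift hx).exists_isConformalNormal (by omega) hu
  obtain ⟨e, a, b, he, ha, -, hab⟩ := hY.exists_eigenbasis hx hA hn hu hξ
  exact ⟨a, encard_range_le_three hab, charpoly_of_eigenbasis he ha⟩

/-- The Blaschke eigenvalues of a connected hypersurface with parallel Blaschke tensor are
constant. -/
theorem IsRegularSpacelike.charpoly_const [IsManifold (𝓡 n) ∞ M] [ConnectedSpace M]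
    (hx : IsRegularSpacelike x) (hA : HasParallelBlaschkeTensor x) (hn : 2 ≤ n) :
    ∃ P : Polynomial ℝ, ∀ φ Y, IsCanonicalLift x φ Y → ∀ u ∈ φ.target,
      (blaschkeOperator Y u).charpoly = P := by
  choose Φ L hL hΦ using fun p => hx.exists_isCanonicalLift hn p
  -- The chosen lift varies with the point. Near `p`, invariance allows comparison within the one
  -- lift chosen at `p`, on a ball, which is convex and hence preconnected.
  have hF : IsLocallyConstant fun p => (blaschkeOperator (L p) (Φ p p)).charpoly := by
    rw [IsLocallyConstant.iff_eventually_eq]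
    intro p
    obtain ⟨r, hr, hball⟩ := Metric.isOpen_iff.1 (Φ p).open_target _ ((Φ p).map_source (hΦ p))
    filter_upwards [(Φ p).open_source.mem_nhds (hΦ p),
      ((Φ p).continuousAt (hΦ p)).preimage_mem_nhds (Metric.ball_mem_nhds _ hr)] with q hq hqr
    rw [(hL p).charpoly_eq (hL q) hx hn hq (hΦ q)]
    exact ((hL p).isLocalLift.isSpacelikeLift hx).charpoly_blaschkeOperator_eq (hA _ _ (hL p))
      hball Metric.isOpen_ball (convex_ball _ _).isPreconnected hqr (Metric.mem_ball_self hr)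
  obtain ⟨p₀⟩ : Nonempty M := inferInstance
  refine ⟨(blaschkeOperator (L p₀) (Φ p₀ p₀)).charpoly, fun φ Y hY u hu => ?_⟩
  have h1 := (hL (φ.symm u)).charpoly_eq hY hx hn (hΦ _) (φ.map_target hu)
  rw [φ.right_inv hu] at h1
  rw [h1]
  exact hF.apply_eq_of_preconnectedSpace _ _

end Hypersurfaces

end ConformalGeometry

end

/-! ### Assembly of the result -/

theorem lemma2p2 {n : ℕ} (hn : 2 ≤ n) {M : Type*} [TopologicalSpace M]
    [ChartedSpace (EuclideanSpace ℝ (Fin n)) M] [IsManifold (𝓡 n) ∞ M] [ConnectedSpace M]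
    (x : M → conformalSpace (n + 1) 1) (hx : IsRegularSpacelike x)
    (hA : HasParallelBlaschkeTensor x) :
    -- the hypersurface is Blaschke isoparametric
    IsBlaschkeIsoparametric x ∧
    -- there are at most three distinct Blaschke eigenvalues
    (∀ p : M, {a : ℝ | IsBlaschkeEigenvalue x p a}.encard ≤ 3) ∧
    -- `A` and `B` commute and have a common `g`-orthonormal eigenbasis, with the stated relation
    (∀ φ Y, IsCanonicalLift x φ Y → ∀ u ∈ φ.target, ∀ ξ, IsConformalNormal Y u ξ →
      Commute (blaschkeOperator Y u) (secondFormOperator Y ξ u) ∧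
      ∃ (e : Fin n → Fin n → ℝ) (a b : Fin n → ℝ),
        (∀ i j, e i ⬝ᵥ (inducedMetric Y u *ᵥ e j) = if i = j then 1 else 0) ∧
        (∀ i, blaschkeOperator Y u *ᵥ e i = a i • e i) ∧
        (∀ i, secondFormOperator Y ξ u *ᵥ e i = b i • e i) ∧
        (∀ i j, a i ≠ a j → a i + a j = b i * b j) ∧
        (3 ≤ (Set.range a).encard → ∀ i j, a i = a j → b i = b j)) := by
  obtain ⟨P, hP⟩ := hx.charpoly_const hA hn
  have hroots : ∀ p : M, ∃ a : Fin n → ℝ, (Set.range a).encard ≤ 3 ∧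
      P = ∏ i, (Polynomial.X - Polynomial.C (a i)) := by
    intro p
    obtain ⟨φ, Y, hY, hp⟩ := hx.exists_isCanonicalLift hn p
    obtain ⟨a, ha, hPa⟩ := hY.exists_charpoly_eq hx hA hn (φ.map_source hp)
    exact ⟨a, ha, (hP φ Y hY _ (φ.map_source hp)).symm.trans hPa⟩
  refine ⟨⟨fun φ Y hY u hu ξ hξ i => hY.conformalForm_eq_zero hx hA hn hu hξ i, ?_⟩,
    fun p => ?_, fun φ Y hY u hu ξ hξ => ⟨hY.commute hx hA hn hu hξ, ?_⟩⟩
  · obtain ⟨p⟩ : Nonempty M := inferInstance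
    obtain ⟨a, -, ha⟩ := hroots p
    exact ⟨a, fun φ Y hY u hu => (hP φ Y hY u hu).trans ha⟩
  · obtain ⟨a, ha, hPa⟩ := hroots p
    refine (Set.encard_le_encard ?_).trans ha
    -- The lift witnessing the eigenvalue may vary with `t`, but all canonical lifts share the
    -- polynomial `P`, so every eigenvalue is one of its roots.
    rintro t ⟨φ, Y, hY, hp, v, hv, htv⟩
    have h1 : P.eval t = 0 := by
      rw [← hP φ Y hY _ (φ.map_source hp), Matrix.eval_charpoly,
        ← Matrix.exists_mulVec_eq_zero_iff]
      refine ⟨v, hv, ?_⟩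
      rw [Matrix.sub_mulVec, htv, sub_eq_zero, Matrix.scalar_apply, ← Matrix.smul_one_eq_diagonal,
        Matrix.smul_mulVec, Matrix.one_mulVec]
    rw [hPa, Polynomial.eval_prod, Finset.prod_eq_zero_iff] at h1
    obtain ⟨i, -, hi⟩ := h1
    rw [Polynomial.eval_sub, Polynomial.eval_X, Polynomial.eval_C, sub_eq_zero] at hi
    exact ⟨i, hi.symm⟩
  · obtain ⟨e, a, b, he, ha, hb, hab⟩ := hY.exists_eigenbasis hx hA hn hu hξ
    exact ⟨e, a, b, he, ha, hb, hab, fun h3 i j hij => eq_of_three_le_encard hab h3 hij⟩
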